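/- Let $(\Omega,\mathcal F,\mathbf P)$ be a probability space on which all random objects below are defined. Write $x^+=\max(x,0)$, $x\wedge y=\min(x,y)$, $\int_0^t=\int_{[0,t]}$, and let $\mathbb D(\mathbb R_+,\mathbb R)$ be the set of right-continuous functions $\mathbb R_+\to\mathbb R$ with left-hand limits. Let $\eta_1,\eta_2,\dots$ be i.i.d. nonnegative random variables with distribution function $F$, where $F(0)<1$, and let $\tilde\eta_1,\tilde\eta_2,\dots$ be nonnegative random variables. For each $n\in\mathbb N$, let $Q^n_0$ be a $\mathbb Z_+$-valued random variable and $E^n=(E^n(t),t\in\mathbb R_+)$ a nondecreasing $\mathbb Z_+$-valued process with trajectories in $\mathbb D(\mathbb R_+,\mathbb R)$, such that $Q^n_0$, $\{\tilde\eta_i\}$, $\{\eta_i\}$ and $E^n$ are independent. (For a first-come-first-served queue with $n$ servers, $Q_0^n$ is the number of customers present at time $0-$, $\tilde\eta_i$ are the remaining service times of those in service at time $0-$, $\eta_i$ are the service times of the customers queued at time $0-$ or arriving later, and $E^n(t)$ is the number of exogenous arrivals by time $t$.) For each $n\in\mathbb N$, let $Q^n$ (the number of customers present) and $A^n$ (the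 number of customers that enter service after time $0-$) be $\mathbb Z_+$-valued processes with trajectories in $\mathbb D(\mathbb R_+,\mathbb R)$, with $A^n$ nondecreasing, that satisfy for all $t\in\mathbb R_+$ $$Q^n(t)=(Q^n_0-n)^++\sum_{i=1}^{Q^n_0\wedge n}\mathbf 1_{\{\tilde\eta_i>t\}}+E^n(t)-\int_0^t\!\!\int_0^t\mathbf 1_{\{s+x\le t\}}\,d\sum_{i=1}^{A^n(s)}\mathbf 1_{\{\eta_i\le x\}},$$ $$A^n(t)=(Q^n_0-n)^++E^n(t)-(Q^n(t)-n)^+ .$$ Here the double integral is with respect to the Lebesgue--Stieltjes measure of $(s,x)\mapsto\sum_{i=1}^{A^n(s)}\mathbf 1_{\{\eta_i\le x\}}$. (When the $\eta_i$ may vanish, these equations need not determine $Q^n$ and $A^n$; any solutions are allowed.) Let $\mathbf q_0\in\mathbb R_+$, let $\tilde F$ be the distribution function of a nonnegative random variable, and let $\mathbf e\in\mathbb D(\mathbb R_+,\mathbb R)$ be nondecreasing. Let $\tilde F^n(t)=\frac1n\sum_{i=1}^n\mathbf 1_{\{\tilde\eta_i\le t\}}$. Suppose that, for arbitrary $T>0$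 and $\varepsilon>0$, as $n\to\infty$, $$\mathbf P\Bigl(\Bigl|\tfrac{Q^n_0}{n}-\mathbf q_0\Bigr|>\varepsilon\Bigr)\to0,\qquad \mathbf P\Bigl(\sup_{t\in[0,T]}|\tilde F^n(t)-\tilde F(t)|>\varepsilon\Bigr)\to0,\qquad \mathbf P\Bigl(\sup_{t\in[0,T]}\Bigl|\tfrac{E^n(t)}{n}-\mathbf e(t)\Bigr|>\varepsilon\Bigr)\to0 .$$ Then there is a unique function $\mathbf q\in\mathbb D(\mathbb R_+,\mathbb R)$ such that for all $t\in\mathbb R_+$ $$\mathbf q(t)=\mathbf q_0-(\mathbf q_0-1)^+F(t)-(\mathbf q_0\wedge1)\tilde F(t)+\mathbf e(t)-\int_0^t\mathbf e(t-s)\,dF(s)+\int_0^t(\mathbf q(t-s)-1)^+\,dF(s),$$ and, with $\mathbf a(t)=(\mathbf q_0-1)^++\mathbf e(t)-(\mathbf q(t)-1)^+$, for arbitrary $T>0$ and $\varepsilon>0$, $$\lim_{n\to\infty}\mathbf P\Bigl(\sup_{t\in[0,T]}\Bigl|\tfrac{Q^n(t)}{n}-\mathbf q(t)\Bigr|>\varepsilon\Bigr)=0,\qquad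 \lim_{n\to\infty}\mathbf P\Bigl(\sup_{t\in[0,T]}\Bigl|\tfrac{A^n(t)}{n}-\mathbf a(t)\Bigr|>\varepsilon\Bigr)=0 .$$ -/

import Mathlib

open MeasureTheory ProbabilityTheory Filter Topology
open scoped NNReal ENNReal

noncomputable section

/-- Membership in `𝔻(ℝ₊, ℝ)`: right-continuous with (finite) left-hand limits. -/
def IsCadlag (x : ℝ≥0 → ℝ) : Prop :=
  ∀ t, ContinuousWithinAt x (Set.Ici t) t ∧ ∃ l, Tendsto x (𝓝[<] t) (𝓝 l)

/-- Uniform convergence on compact intervals in probability of the processes `X n` to the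
deterministic function `x`. The supremum is taken in `[0, ∞]`. -/
def TendstoUCP {Ω : Type*} [MeasurableSpace Ω] (P : Measure Ω) (X : ℕ → ℝ≥0 → Ω → ℝ)
    (x : ℝ≥0 → ℝ) : Prop :=
  ∀ T : ℝ≥0, 0 < T → ∀ ε : ℝ, 0 < ε →
    Tendsto (fun n => P {ω | ENNReal.ofReal ε < ⨆ t ∈ Set.Icc 0 T, ‖X n t ω - x t‖ₑ})
      atTop (𝓝 0)

/-- The empirical distribution function of the first `n` members of a sequence. -/
def empiricalCDF (y : ℕ → ℝ≥0) (n : ℕ) (t : ℝ≥0) : ℝ :=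
  (n : ℝ)⁻¹ * ∑ i ∈ Finset.range n, if y i ≤ t then 1 else 0

/-- The time `inf {t : A t ≥ i + 1}` at which customer number `i` (counted from `0`) enters
service, for an entrance process `A`. Only used for customers that do enter service. -/
def entryTime (A : ℝ≥0 → ℕ) (i : ℕ) : ℝ≥0 := sInf {t | i + 1 ≤ A t}

/-- The Lebesgue-Stieltjes measure on `ℝ₊ × ℝ₊` of the function
`(s, x) ↦ ∑_{i ≤ A s} 1{η_i ≤ x}` (see `entryMeasure_rect`): a unit mass at
(time of entering service, service time) for each customer that ever enters service. -/
def entryMeasure (A : ℝ≥0 → ℕ) (η : ℕ → ℝ≥0) : Measure (ℝ≥0 × ℝ≥0) :=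
  Measure.sum fun i : {i : ℕ // ∃ t, i + 1 ≤ A t} => Measure.dirac (entryTime A i, η i)

/-- `∫₀ᵗ ∫₀ᵗ 1{s + x ≤ t} d ∑_{i ≤ A s} 1{η_i ≤ x}`, the number of departures by time `t` among
the customers that enter service after time `0-`. -/
def departures (A : ℝ≥0 → ℕ) (η : ℕ → ℝ≥0) (t : ℝ≥0) : ℝ :=
  ∫ p in Set.Icc 0 t ×ˢ Set.Icc 0 t, (if p.1 + p.2 ≤ t then (1 : ℝ) else 0) ∂(entryMeasure A η)

theorem le_iff_entryTime_le {A : ℝ≥0 → ℕ} (hA : Monotone A)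
    (hA' : IsCadlag fun t => (A t : ℝ)) (i : ℕ) (s : ℝ≥0) :
    i + 1 ≤ A s ↔ (∃ t, i + 1 ≤ A t) ∧ entryTime A i ≤ s := by
  constructor
  · intro h
    exact ⟨⟨s, h⟩, csInf_le (OrderBot.bddBelow _) h⟩
  · rintro ⟨hne, hs⟩
    refine le_trans ?_ (hA hs)
    by_contra hlt
    push Not at hlt
    have hc := (hA' (entryTime A i)).1
    have hev : ∀ᶠ u in 𝓝[≥] (entryTime A i), (A u : ℝ) < i + 1 := by
      refine Tendsto.eventually_lt_const ?_ hc
      show (A (entryTime A i) : ℝ) < i + 1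
      exact_mod_cast hlt
    obtain ⟨u, hu, hIco⟩ := (mem_nhdsGE_iff_exists_Ico_subset).1 hev
    obtain ⟨v, hv, hvu⟩ := exists_lt_of_csInf_lt (s := {t | i + 1 ≤ A t}) hne hu
    have hv' : entryTime A i ≤ v := csInf_le (OrderBot.bddBelow _) hv
    have := hIco ⟨hv', hvu⟩
    have h2 : A v < i + 1 := by exact_mod_cast this
    exact absurd hv (not_le.2 h2)

theorem entryMeasure_apply {A : ℝ≥0 → ℕ} (hA : Monotone A)
    (hA' : IsCadlag fun t => (A t : ℝ)) (η : ℕ → ℝ≥0) (s : ℝ≥0) {S : Set (ℝ≥0 × ℝ≥0)}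
    (hS : MeasurableSet S) (hSs : ∀ p ∈ S, p.1 ≤ s) [DecidablePred (· ∈ S)] :
    entryMeasure A η S
      = (((Finset.range (A s)).filter fun i => (entryTime A i, η i) ∈ S).card : ℝ≥0∞) := by
  classical
  have key : entryMeasure A η S = ∑' i : ℕ, Set.indicator {i : ℕ | ∃ t, i + 1 ≤ A t}
      (fun i => S.indicator (1 : ℝ≥0 × ℝ≥0 → ℝ≥0∞) (entryTime A i, η i)) i := by
    rw [entryMeasure, Measure.sum_apply _ hS, ← tsum_subtype]
    exact tsum_congr fun i => Measure.dirac_apply' _ hS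
  rw [key, tsum_eq_sum (s := (Finset.range (A s)).filter fun i => (entryTime A i, η i) ∈ S)]
  · rw [Finset.cast_card]
    refine Finset.sum_congr rfl fun i hi => ?_
    rw [Finset.mem_filter, Finset.mem_range] at hi
    rw [Set.indicator_of_mem (show i ∈ {i : ℕ | ∃ t, i + 1 ≤ A t} from ⟨s, hi.1⟩),
      Set.indicator_of_mem hi.2, Pi.one_apply]
  · intro i hi
    by_cases h1 : ∃ t, i + 1 ≤ A t
    · rw [Set.indicator_of_mem (show i ∈ {i : ℕ | ∃ t, i + 1 ≤ A t} from h1),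
        Set.indicator_of_notMem]
      intro h2
      exact hi (Finset.mem_filter.2 ⟨Finset.mem_range.2
        ((le_iff_entryTime_le hA hA' i s).2 ⟨h1, hSs _ h2⟩), h2⟩)
    · exact Set.indicator_of_notMem (s := {i : ℕ | ∃ t, i + 1 ≤ A t}) h1 _

/-- The masses that `entryMeasure` gives to the rectangles `[0, s] × [0, x]`. -/
theorem entryMeasure_rect {A : ℝ≥0 → ℕ} (hA : Monotone A)
    (hA' : IsCadlag fun t => (A t : ℝ)) (η : ℕ → ℝ≥0) (s x : ℝ≥0) :
    entryMeasure A η (Set.Icc 0 s ×ˢ Set.Icc 0 x)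
      = ∑ i ∈ Finset.range (A s), if η i ≤ x then 1 else 0 := by
  classical
  rw [entryMeasure_apply hA hA' η s (measurableSet_Icc.prod measurableSet_Icc)
    (fun p hp => hp.1.2), Finset.card_filter, Nat.cast_sum]
  refine Finset.sum_congr rfl fun i hi => ?_
  have := ((le_iff_entryTime_le hA hA' i s).1 (Finset.mem_range.1 hi)).2
  simp [this]

/-- The double integral counts the customers `i` among those that have entered service by time
`t` whose entrance time plus service time is at most `t`. -/
theorem departures_eq_sum {A : ℝ≥0 → ℕ} (hA : Monotone A)
    (hA' : IsCadlag fun t => (A t : ℝ)) (η : ℕ → ℝ≥0) (t : ℝ≥0) :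
    departures A η t
      = ∑ i ∈ Finset.range (A t), if entryTime A i + η i ≤ t then (1 : ℝ) else 0 := by
  classical
  have hm : MeasurableSet {p : ℝ≥0 × ℝ≥0 | p.1 + p.2 ≤ t} :=
    measurableSet_le (by fun_prop) (by fun_prop)
  have h1 : (fun p : ℝ≥0 × ℝ≥0 => if p.1 + p.2 ≤ t then (1 : ℝ) else 0)
      = Set.indicator {p : ℝ≥0 × ℝ≥0 | p.1 + p.2 ≤ t} 1 := by
    ext p; simp [Set.indicator_apply]
  have hsub : {p : ℝ≥0 × ℝ≥0 | p.1 + p.2 ≤ t} ∩ Set.Icc 0 t ×ˢ Set.Icc 0 t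
      = {p : ℝ≥0 × ℝ≥0 | p.1 + p.2 ≤ t} := by
    refine Set.inter_eq_left.2 fun p hp => ?_
    exact ⟨⟨zero_le, le_trans le_self_add hp⟩, ⟨zero_le, le_trans le_add_self hp⟩⟩
  rw [departures, h1, integral_indicator_one hm, measureReal_restrict_apply hm, hsub,
    Measure.real, entryMeasure_apply hA hA' η t hm (fun p hp => le_trans le_self_add hp),
    ENNReal.toReal_natCast, Finset.card_filter, Nat.cast_sum]
  refine Finset.sum_congr rfl fun i _ => ?_
  simp

/-- The number of customers remaining in service at time `t` out of those in service at time
`0-`, when `Q₀` customers are present at time `0-` in front of `n` servers. -/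
def residualCount (n Q₀ : ℕ) (ηt : ℕ → ℝ≥0) (t : ℝ≥0) : ℝ :=
  ∑ i ∈ Finset.range (min Q₀ n), if t < ηt i then 1 else 0

/-- Trajectories `Q` (number of customers present) and `A` (number of customers that have entered
service after time `0-`) that solve the equations of the first-come-first-served queue with `n`
servers, for given initial number of customers `Q₀`, remaining service times `ηt`, service times
`η` and arrival trajectory `E`. -/
structure IsQueueSolution (n Q₀ : ℕ) (ηt η : ℕ → ℝ≥0) (E Q A : ℝ≥0 → ℕ) : Prop where
  cadlag_Q : IsCadlag fun t => (Q t : ℝ)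
  cadlag_A : IsCadlag fun t => (A t : ℝ)
  mono_A : Monotone A
  eq_Q : ∀ t, (Q t : ℝ) =
    max ((Q₀ : ℝ) - n) 0 + residualCount n Q₀ ηt t + E t - departures A η t
  eq_A : ∀ t, (A t : ℝ) = max ((Q₀ : ℝ) - n) 0 + E t - max ((Q t : ℝ) - n) 0

/-- The fluid limit equation for `q ∈ 𝔻(ℝ₊, ℝ)`. The distribution functions of the probability
measures `F` and `Ft` on `ℝ₊` are `t ↦ F.real (Set.Iic t)` and `t ↦ Ft.real (Set.Iic t)`. -/
structure IsFluidSolution (F Ft : Measure ℝ≥0) (q₀ : ℝ) (e q : ℝ≥0 → ℝ) : Prop where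
  cadlag : IsCadlag q
  eq : ∀ t, q t = q₀ - max (q₀ - 1) 0 * F.real (Set.Iic t) - min q₀ 1 * Ft.real (Set.Iic t) + e t
    - (∫ s in Set.Icc 0 t, e (t - s) ∂F) + ∫ s in Set.Icc 0 t, max (q (t - s) - 1) 0 ∂F

/-- The fluid limit of the number of customers that have entered service. -/
def fluidEntrance (q₀ : ℝ) (e q : ℝ≥0 → ℝ) (t : ℝ≥0) : ℝ :=
  max (q₀ - 1) 0 + e t - max (q t - 1) 0

end

noncomputable section

namespace IsCadlag

theorem of_continuous {x : ℝ≥0 → ℝ} (hx : Continuous x) : IsCadlag x := fun t =>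
  ⟨hx.continuousWithinAt, x t, hx.continuousAt.tendsto.mono_left nhdsWithin_le_nhds⟩

theorem add {x y : ℝ≥0 → ℝ} (hx : IsCadlag x) (hy : IsCadlag y) :
    IsCadlag fun t => x t + y t := fun t => by
  obtain ⟨h1, l1, h2⟩ := hx t
  obtain ⟨h3, l2, h4⟩ := hy t
  exact ⟨h1.add h3, _, h2.add h4⟩

theorem comp_continuous {x : ℝ≥0 → ℝ} (hx : IsCadlag x) {φ : ℝ → ℝ} (hφ : Continuous φ) :
    IsCadlag fun t => φ (x t) := fun t => by
  obtain ⟨h1, l1, h2⟩ := hx t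
  exact ⟨hφ.continuousAt.comp_continuousWithinAt h1, φ l1, (hφ.tendsto l1).comp h2⟩

theorem sub {x y : ℝ≥0 → ℝ} (hx : IsCadlag x) (hy : IsCadlag y) :
    IsCadlag fun t => x t - y t := by
  simpa [sub_eq_add_neg] using hx.add (hy.comp_continuous continuous_neg)

theorem const_mul {x : ℝ≥0 → ℝ} (hx : IsCadlag x) (c : ℝ) : IsCadlag fun t => c * x t :=
  hx.comp_continuous (continuous_const_mul c)

theorem div_const {x : ℝ≥0 → ℝ} (hx : IsCadlag x) (c : ℝ) : IsCadlag fun t => x t / c :=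
  hx.comp_continuous (continuous_id.div_const c)

theorem measurable {x : ℝ≥0 → ℝ} (hx : IsCadlag x) : Measurable x := by
  let r : ℕ → ℝ≥0 → ℝ≥0 := fun n t => ((⌊((n : ℝ≥0) + 1) * t⌋₊ : ℝ≥0) + 1) / ((n : ℝ≥0) + 1)
  have hr : ∀ t, Tendsto (fun n => r n t) atTop (𝓝[≥] t) := by
    intro t
    have hge : ∀ n, t ≤ r n t := fun n => by
      rw [le_div_iff₀ (by positivity), mul_comm]
      exact (Nat.lt_floor_add_one _).le
    have hle : ∀ n, r n t ≤ t + 1 / ((n : ℝ≥0) + 1) := fun n => by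
      rw [div_le_iff₀ (by positivity), add_mul t, div_mul_cancel₀ _ (by positivity), mul_comm t]
      gcongr
      exact Nat.floor_le zero_le
    refine tendsto_nhdsWithin_iff.2 ⟨?_, .of_forall hge⟩
    refine tendsto_of_tendsto_of_tendsto_of_le_of_le tendsto_const_nhds ?_ hge hle
    have := (tendsto_one_div_add_atTop_nhds_zero_nat (𝕜 := ℝ≥0)).const_add t
    simpa using this
  refine measurable_of_tendsto_metrizable (f := fun n t => x (r n t)) (fun n => ?_) ?_
  · exact (measurable_from_nat
      (f := fun k : ℕ => x (((k : ℝ≥0) + 1) / ((n : ℝ≥0) + 1)))).comp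
      (Nat.measurable_floor.comp (measurable_const_mul _))
  · rw [tendsto_pi_nhds]
    exact fun t => (hx t).1.tendsto.comp (hr t)

theorem exists_bound {x : ℝ≥0 → ℝ} (hx : IsCadlag x) (T : ℝ≥0) :
    ∃ C, 0 ≤ C ∧ ∀ t ≤ T, |x t| ≤ C := by
  have h : ∃ C, ∀ t ∈ Set.Icc 0 T, |x t| ≤ C := by
    refine isCompact_Icc.induction_on (p := fun s => ∃ C, ∀ t ∈ s, |x t| ≤ C) ⟨0, by simp⟩
      (fun s t hst ⟨C, hC⟩ => ⟨C, fun u hu => hC u (hst hu)⟩)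
      (fun s t ⟨C, hC⟩ ⟨D, hD⟩ => ⟨max C D, ?_⟩) fun t _ => ?_
    · rintro u (hu | hu)
      · exact (hC u hu).trans (le_max_left _ _)
      · exact (hD u hu).trans (le_max_right _ _)
    · obtain ⟨h1, l, h2⟩ := hx t
      have e1 := h1.tendsto.abs.eventually_lt_const (lt_add_one _)
      have e2 := h2.abs.eventually_lt_const (lt_add_one _)
      refine ⟨{u | |x u| < |x t| + 1} ∪ {u | |x u| < |l| + 1}, ?_,
        max (|x t| + 1) (|l| + 1), ?_⟩
      · refine mem_nhdsWithin_of_mem_nhds ?_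
        rw [← nhdsLT_sup_nhdsGE]
        exact ⟨mem_of_superset e2 Set.subset_union_right,
          mem_of_superset e1 Set.subset_union_left⟩
      · rintro u (hu | hu)
        · exact (le_of_lt hu).trans (le_max_left _ _)
        · exact (le_of_lt hu).trans (le_max_right _ _)
  obtain ⟨C, hC⟩ := h
  exact ⟨C, (abs_nonneg _).trans (hC 0 ⟨le_rfl, zero_le⟩), fun t ht => hC t ⟨zero_le, ht⟩⟩

/-- Local uniform limits of càdlàg functions are càdlàg. -/
theorem of_forall_approx {x : ℝ≥0 → ℝ}
    (h : ∀ T : ℝ≥0, ∀ ε > 0, ∃ y, IsCadlag y ∧ ∀ t ≤ T, |x t - y t| ≤ ε) : IsCadlag x := by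
  intro t
  constructor
  · rw [Metric.continuousWithinAt_iff']
    intro ε hε
    obtain ⟨y, hy, hxy⟩ := h (t + 1) (ε / 4) (by positivity)
    have h1 := Metric.continuousWithinAt_iff'.1 (hy t).1 (ε / 4) (by positivity)
    have h2 : ∀ᶠ u in 𝓝[≥] t, u ≤ t + 1 :=
      mem_nhdsWithin_of_mem_nhds (Iic_mem_nhds (by simp))
    filter_upwards [h1, h2] with u hu hu'
    have a1 := abs_le.1 (hxy u hu')
    have a2 := abs_le.1 (hxy t (by simp))
    rw [Real.dist_eq] at hu ⊢
    have a3 := abs_lt.1 hu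
    rw [abs_lt]
    constructor <;> linarith [a1.1, a1.2, a2.1, a2.2, a3.1, a3.2]
  · rcases eq_or_neBot (𝓝[<] t) with hb | hb
    · exact ⟨0, by rw [hb]; exact tendsto_bot⟩
    · refine cauchy_map_iff_exists_tendsto.1 (Metric.cauchy_iff.2 ⟨hb.map _, fun ε hε => ?_⟩)
      obtain ⟨y, hy, hxy⟩ := h t (ε / 8) (by positivity)
      obtain ⟨-, l, hl⟩ := hy t
      have h1 := (Metric.tendsto_nhds.1 hl) (ε / 8) (by positivity)
      have h2 : ∀ᶠ u in 𝓝[<] t, |x u - l| < ε / 4 := by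
        filter_upwards [h1, self_mem_nhdsWithin] with u hu hut
        have a1 := abs_le.1 (hxy u (le_of_lt hut))
        rw [Real.dist_eq] at hu
        have a3 := abs_lt.1 hu
        rw [abs_lt]
        constructor <;> linarith [a1.1, a1.2, a3.1, a3.2]
      refine ⟨{v | |v - l| < ε / 4}, h2, fun v hv w hw => ?_⟩
      have a1 := abs_lt.1 (show |v - l| < ε / 4 from hv)
      have a2 := abs_lt.1 (show |w - l| < ε / 4 from hw)
      rw [Real.dist_eq, abs_lt]
      constructor <;> linarith [a1.1, a1.2, a2.1, a2.2]

end IsCadlag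


/-- The convolution `∫₀ᵗ g (t - s) dF(s)` on the half-line. -/
def stieltjesConv (F : Measure ℝ≥0) (g : ℝ≥0 → ℝ) (t : ℝ≥0) : ℝ :=
  ∫ s in Set.Icc 0 t, g (t - s) ∂F

theorem stieltjesConv_const (F : Measure ℝ≥0) (c : ℝ) (t : ℝ≥0) :
    stieltjesConv F (fun _ => c) t = c * F.real (Set.Iic t) := by
  have : Set.Icc 0 t = Set.Iic t := by ext; simp
  simp [stieltjesConv, this, mul_comm]

/-- The Laplace transform of `F` at `1`. -/
def laplaceOne (F : Measure ℝ≥0) : ℝ := ∫ s, Real.exp (-(s : ℝ)) ∂F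

theorem laplaceOne_nonneg (F : Measure ℝ≥0) : 0 ≤ laplaceOne F :=
  integral_nonneg fun _ => (Real.exp_pos _).le

section Conv

variable {F : Measure ℝ≥0} [IsProbabilityMeasure F]

theorem integrableOn_comp_tsub {g : ℝ≥0 → ℝ} (hg : IsCadlag g) (t : ℝ≥0) :
    IntegrableOn (fun s => g (t - s)) (Set.Icc 0 t) F := by
  obtain ⟨C, -, hC⟩ := hg.exists_bound t
  exact Measure.integrableOn_of_bounded (M := C) (measure_ne_top _ _)
    (hg.measurable.comp (measurable_const.sub measurable_id)).aestronglyMeasurable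
    (.of_forall fun s => hC _ tsub_le_self)

theorem stieltjesConv_add {f g : ℝ≥0 → ℝ} (hf : IsCadlag f) (hg : IsCadlag g) (t : ℝ≥0) :
    stieltjesConv F (fun s => f s + g s) t = stieltjesConv F f t + stieltjesConv F g t :=
  integral_add (integrableOn_comp_tsub hf t) (integrableOn_comp_tsub hg t)

theorem stieltjesConv_sub {f g : ℝ≥0 → ℝ} (hf : IsCadlag f) (hg : IsCadlag g) (t : ℝ≥0) :
    stieltjesConv F (fun s => f s - g s) t = stieltjesConv F f t - stieltjesConv F g t :=
  integral_sub (integrableOn_comp_tsub hf t) (integrableOn_comp_tsub hg t)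

theorem IsCadlag.stieltjesConv {g : ℝ≥0 → ℝ} (hg : IsCadlag g) :
    IsCadlag (stieltjesConv F g) := by
  intro t
  obtain ⟨C, hC0, hC⟩ := hg.exists_bound (t + 1)
  let φ : ℝ≥0 → ℝ≥0 → ℝ := fun u => (Set.Icc 0 u).indicator fun s => g (u - s)
  have hφ : ∀ u, _root_.stieltjesConv F g u = ∫ s, φ u s ∂F := fun u =>
    (integral_indicator measurableSet_Icc).symm
  have hm : ∀ u, AEStronglyMeasurable (φ u) F := fun u =>
    ((hg.measurable.comp (measurable_const.sub measurable_id)).indicator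
      measurableSet_Icc).aestronglyMeasurable
  have hb : ∀ u ≤ t + 1, ∀ s, ‖φ u s‖ ≤ C := fun u hu s => by
    refine (norm_indicator_le_norm_self _ _).trans ?_
    exact hC _ (tsub_le_self.trans hu)
  have hnear : ∀ᶠ u in 𝓝 t, u ≤ t + 1 := Iic_mem_nhds (by simp)
  constructor
  · have : Tendsto (fun u => ∫ s, φ u s ∂F) (𝓝[≥] t) (𝓝 (∫ s, φ t s ∂F)) := by
      refine tendsto_integral_filter_of_dominated_convergence (fun _ => C)
        (.of_forall hm) ?_ (integrable_const _) (.of_forall fun s => ?_)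
      · filter_upwards [mem_nhdsWithin_of_mem_nhds hnear] with u hu
        exact .of_forall (hb u hu)
      · rcases le_or_gt s t with hs | hs
        · have h1 : Tendsto (fun u => u - s) (𝓝[≥] t) (𝓝[≥] (t - s)) := by
            refine tendsto_nhdsWithin_iff.2 ⟨?_, ?_⟩
            · exact ((continuous_id.sub continuous_const).tendsto t).mono_left nhdsWithin_le_nhds
            · filter_upwards [self_mem_nhdsWithin] with u hu
              exact tsub_le_tsub_right hu s
          have h2 := (hg (t - s)).1.tendsto.comp h1
          have h3 : φ t s = g (t - s) :=
            Set.indicator_of_mem (show s ∈ Set.Icc 0 t from ⟨zero_le, hs⟩) _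
          rw [h3]
          refine h2.congr' ?_
          filter_upwards [self_mem_nhdsWithin] with u hu
          exact (Set.indicator_of_mem (show s ∈ Set.Icc 0 u from ⟨zero_le, hs.trans hu⟩)
            fun s => g (u - s)).symm
        · have h3 : φ t s = 0 := Set.indicator_of_notMem (fun h => not_le.2 hs h.2) _
          rw [h3]
          refine tendsto_const_nhds.congr' ?_
          filter_upwards [mem_nhdsWithin_of_mem_nhds (Iio_mem_nhds hs)] with u hu
          exact (Set.indicator_of_notMem (fun h => not_le.2 hu h.2) _).symm
    rw [ContinuousWithinAt, hφ t]
    exact this.congr fun u => (hφ u).symm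
  · choose gl hgl using fun u => (hg u).2
    let ψ : ℝ≥0 → ℝ := fun s => if s < t then gl (t - s) else 0
    have : Tendsto (fun u => ∫ s, φ u s ∂F) (𝓝[<] t) (𝓝 (∫ s, ψ s ∂F)) := by
      refine tendsto_integral_filter_of_dominated_convergence (fun _ => C)
        (.of_forall hm) ?_ (integrable_const _) (.of_forall fun s => ?_)
      · filter_upwards [mem_nhdsWithin_of_mem_nhds hnear] with u hu
        exact .of_forall (hb u hu)
      · rcases lt_or_ge s t with hs | hs
        · have hev : ∀ᶠ u in 𝓝[<] t, s < u := mem_nhdsWithin_of_mem_nhds (Ioi_mem_nhds hs)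
          have h1 : Tendsto (fun u => u - s) (𝓝[<] t) (𝓝[<] (t - s)) := by
            refine tendsto_nhdsWithin_iff.2 ⟨?_, ?_⟩
            · exact ((continuous_id.sub continuous_const).tendsto t).mono_left nhdsWithin_le_nhds
            · filter_upwards [self_mem_nhdsWithin, hev] with u hu hsu
              exact tsub_lt_tsub_right_of_le hsu.le hu
          have h2 := (hgl (t - s)).comp h1
          have h3 : ψ s = gl (t - s) := if_pos hs
          rw [h3]
          refine h2.congr' ?_
          filter_upwards [hev] with u hu
          exact (Set.indicator_of_mem (show s ∈ Set.Icc 0 u from ⟨zero_le, hu.le⟩)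
            fun s => g (u - s)).symm
        · have h3 : ψ s = 0 := if_neg (not_lt.2 hs)
          rw [h3]
          refine tendsto_const_nhds.congr' ?_
          filter_upwards [self_mem_nhdsWithin] with u hu
          exact (Set.indicator_of_notMem (fun h => not_le.2 (lt_of_lt_of_le hu hs) h.2) _).symm
    exact ⟨_, this.congr fun u => (hφ u).symm⟩

/-- The distribution function of a probability measure on the half-line is càdlàg. -/
theorem isCadlag_real_Iic (F : Measure ℝ≥0) [IsProbabilityMeasure F] :
    IsCadlag fun t => F.real (Set.Iic t) := by
  have h := (IsCadlag.of_continuous (continuous_const (y := (1 : ℝ)))).stieltjesConv (F := F)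
  simpa [funext (stieltjesConv_const F 1)] using h

theorem integrable_exp_neg : Integrable (fun s : ℝ≥0 => Real.exp (-(s : ℝ))) F := by
  refine Integrable.of_bound (by fun_prop) 1 (.of_forall fun s => ?_)
  simp

theorem laplaceOne_lt_one (hF : F.real (Set.Iic 0) < 1) : laplaceOne F < 1 := by
  have h0 : 0 < ∫ s : ℝ≥0, (1 - Real.exp (-(s : ℝ))) ∂F := by
    have hi : Integrable (fun s : ℝ≥0 => 1 - Real.exp (-(s : ℝ))) F :=
      (integrable_const _).sub integrable_exp_neg
    rw [integral_pos_iff_support_of_nonneg (fun s => by simp) hi]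
    have hs : Function.support (fun s : ℝ≥0 => 1 - Real.exp (-(s : ℝ))) = (Set.Iic 0)ᶜ := by
      ext s
      rw [Function.mem_support, sub_ne_zero, ne_comm]
      simp [pos_iff_ne_zero]
    rw [hs, pos_iff_ne_zero]
    intro h
    rw [prob_compl_eq_zero_iff measurableSet_Iic] at h
    simp [Measure.real, h] at hF
  rw [integral_sub (integrable_const _) integrable_exp_neg] at h0
  simp at h0
  exact h0

theorem abs_stieltjesConv_le {g : ℝ≥0 → ℝ} {t : ℝ≥0} {κ M : ℝ} (hκ : 0 ≤ κ) (hM : 0 ≤ M)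
    (hg : ∀ s ≤ t, |g s| ≤ κ + M * Real.exp s) :
    |stieltjesConv F g t| ≤ κ + laplaceOne F * M * Real.exp t := by
  have hi : Integrable (fun s : ℝ≥0 => κ + M * Real.exp t * Real.exp (-(s : ℝ))) F :=
    (integrable_const _).add (integrable_exp_neg.const_mul _)
  have h1 : |stieltjesConv F g t|
      ≤ ∫ s in Set.Icc 0 t, (κ + M * Real.exp t * Real.exp (-(s : ℝ))) ∂F := by
    rw [← Real.norm_eq_abs]
    refine norm_integral_le_of_norm_le hi.integrableOn ?_
    refine (ae_restrict_iff' measurableSet_Icc).2 (.of_forall fun s hs => ?_)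
    refine (hg _ tsub_le_self).trans (le_of_eq ?_)
    rw [NNReal.coe_sub hs.2, mul_assoc, ← Real.exp_add, sub_eq_add_neg]
  refine h1.trans ((setIntegral_le_integral hi (.of_forall fun s => ?_)).trans (le_of_eq ?_))
  · simp only [Pi.zero_apply]; positivity
  · rw [integral_add (integrable_const _) (integrable_exp_neg.const_mul _), integral_const_mul]
    simp [laplaceOne]
    ring

end Conv

/-- A Gronwall inequality in the norm weighted by `exp (-t)`. -/
theorem le_of_weighted_contraction {u : ℝ≥0 → ℝ} {T : ℝ≥0} {κ L C : ℝ} (hL1 : L < 1)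
    (hu0 : ∀ t ≤ T, 0 ≤ u t) (hκ : 0 ≤ κ) (hC : ∀ t ≤ T, u t ≤ C)
    (h : ∀ M, 0 ≤ M → (∀ s ≤ T, u s ≤ M * Real.exp s) →
      ∀ t ≤ T, u t ≤ κ + L * M * Real.exp t) :
    ∀ t ≤ T, u t ≤ κ / (1 - L) * Real.exp t := by
  let S : Set ℝ := (fun t : ℝ≥0 => u t * Real.exp (-(t : ℝ))) '' Set.Iic T
  have hbdd : BddAbove S := by
    refine ⟨C, ?_⟩
    rintro _ ⟨t, ht, rfl⟩
    have h1 := hC t ht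
    have : u t * Real.exp (-(t : ℝ)) ≤ u t * 1 :=
      mul_le_mul_of_nonneg_left (by simp) (hu0 t ht)
    simp only; linarith
  have hle : ∀ s ≤ T, u s ≤ sSup S * Real.exp s := fun s hs => by
    have h1 : u s * Real.exp (-(s : ℝ)) ≤ sSup S := le_csSup hbdd ⟨s, hs, rfl⟩
    rw [Real.exp_neg, ← div_eq_mul_inv, div_le_iff₀ (Real.exp_pos _)] at h1
    exact h1
  have hM0 : 0 ≤ sSup S :=
    (mul_nonneg (hu0 0 zero_le) (Real.exp_pos _).le).trans
      (le_csSup hbdd ⟨0, Set.mem_Iic.2 zero_le, rfl⟩)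
  have hM : sSup S ≤ κ + L * sSup S := by
    refine csSup_le ⟨_, 0, Set.mem_Iic.2 zero_le, rfl⟩ ?_
    rintro _ ⟨t, ht, rfl⟩
    have h1 := h _ hM0 hle t ht
    simp only
    rw [Real.exp_neg, ← div_eq_mul_inv, div_le_iff₀ (Real.exp_pos _)]
    have : κ * 1 ≤ κ * Real.exp t := mul_le_mul_of_nonneg_left (by simp) hκ
    linarith
  intro t ht
  refine (hle t ht).trans (mul_le_mul_of_nonneg_right ?_ (Real.exp_pos _).le)
  rw [le_div_iff₀ (by linarith)]
  linarith

section Volterra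

variable {F : Measure ℝ≥0} [IsProbabilityMeasure F]

theorem abs_stieltjesConv_sub_le {f g : ℝ≥0 → ℝ} (hf : IsCadlag f) (hg : IsCadlag g)
    {t : ℝ≥0} {κ M : ℝ} (hκ : 0 ≤ κ) (hM : 0 ≤ M)
    (h : ∀ s ≤ t, |f s - g s| ≤ κ + M * Real.exp s) :
    |stieltjesConv F f t - stieltjesConv F g t| ≤ κ + laplaceOne F * M * Real.exp t := by
  rw [← stieltjesConv_sub hf hg]
  exact abs_stieltjesConv_le hκ hM h

theorem abs_max_sub_zero_sub_le (a b c d : ℝ) :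
    |max (a - c) 0 - max (b - d) 0| ≤ |(a - c) - (b - d)| := by
  simpa using abs_max_sub_max_le_max (a - c) 0 (b - d) 0

theorem IsCadlag.max_sub_one {x : ℝ≥0 → ℝ} (hx : IsCadlag x) :
    IsCadlag fun t => max (x t - 1) 0 :=
  hx.comp_continuous (φ := fun y => max (y - 1) 0) (by fun_prop)

/-- The Picard iterates for `x = z + (x - 1)⁺ ∗ F`. -/
def picardIterate (F : Measure ℝ≥0) (z : ℝ≥0 → ℝ) : ℕ → ℝ≥0 → ℝ
  | 0 => z
  | k + 1 => fun t => z t + stieltjesConv F (fun s => max (picardIterate F z k s - 1) 0) t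

theorem isCadlag_picardIterate {z : ℝ≥0 → ℝ} (hz : IsCadlag z) :
    ∀ k, IsCadlag (picardIterate F z k)
  | 0 => hz
  | k + 1 => hz.add (isCadlag_picardIterate hz k).max_sub_one.stieltjesConv

theorem exists_volterra_solution (hF : F.real (Set.Iic 0) < 1) {z : ℝ≥0 → ℝ}
    (hz : IsCadlag z) :
    ∃ x, IsCadlag x ∧ ∀ t, x t = z t + stieltjesConv F (fun s => max (x s - 1) 0) t := by
  set L := laplaceOne F with hL
  have hL0 : 0 ≤ L := laplaceOne_nonneg F
  have hL1 : L < 1 := laplaceOne_lt_one hF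
  let y := picardIterate F z
  have hy : ∀ k, IsCadlag (y k) := isCadlag_picardIterate hz
  have hstep : ∀ T : ℝ≥0, ∃ C, 0 ≤ C ∧ ∀ k, ∀ t ≤ T,
      |y k t - y (k + 1) t| ≤ C * L ^ k * Real.exp t := by
    intro T
    obtain ⟨C, hC0, hC⟩ := ((hy 0).sub (hy 1)).exists_bound T
    refine ⟨C, hC0, fun k => ?_⟩
    induction k with
    | zero =>
      intro t ht
      have h1 : C * 1 ≤ C * Real.exp t := mul_le_mul_of_nonneg_left (by simp) hC0
      have := hC t ht
      simp only [zero_add, pow_zero, mul_one]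
      linarith
    | succ k ih =>
      intro t ht
      have h1 := abs_stieltjesConv_sub_le (F := F) (hy k).max_sub_one (hy (k + 1)).max_sub_one
        (t := t) le_rfl (M := C * L ^ k) (by positivity) (fun s hs => by
          refine (abs_max_sub_zero_sub_le _ _ _ _).trans ?_
          have := ih s (hs.trans ht)
          simpa using this)
      have h2 : y (k + 1) t - y (k + 1 + 1) t
          = stieltjesConv F (fun s => max (y k s - 1) 0) t
            - stieltjesConv F (fun s => max (y (k + 1) s - 1) 0) t := by
        simp only [y, picardIterate]; ring
      rw [h2]
      refine h1.trans (le_of_eq ?_)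
      rw [← hL]; ring
  have hlim : ∀ t, ∃ l, Tendsto (fun k => y k t) atTop (𝓝 l) := by
    intro t
    obtain ⟨C, hC0, hC⟩ := hstep t
    refine cauchySeq_tendsto_of_complete
      (cauchySeq_of_le_geometric L (C * Real.exp t) hL1 fun k => ?_)
    rw [Real.dist_eq]
    exact (hC k t le_rfl).trans (le_of_eq (by ring))
  choose x hx using hlim
  have hunif : ∀ T : ℝ≥0, ∃ D, 0 ≤ D ∧ ∀ k, ∀ t ≤ T, |y k t - x t| ≤ D * L ^ k := by
    intro T
    obtain ⟨C, hC0, hC⟩ := hstep T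
    have hpos : 0 < 1 - L := by linarith
    refine ⟨C * Real.exp T / (1 - L), by positivity, fun k t ht => ?_⟩
    have h1 := dist_le_of_le_geometric_of_tendsto L (C * Real.exp T) hL1
      (f := fun k => y k t) (fun k => by
        rw [Real.dist_eq]
        refine (hC k t ht).trans ?_
        have : Real.exp t ≤ Real.exp T := Real.exp_le_exp.2 (by exact_mod_cast ht)
        calc C * L ^ k * Real.exp t ≤ C * L ^ k * Real.exp T := by gcongr
          _ = C * Real.exp T * L ^ k := by ring) (hx t) k
    rw [Real.dist_eq] at h1
    exact h1.trans (le_of_eq (by ring))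
  have hsmall : ∀ D ε : ℝ, 0 < ε → ∃ k, D * L ^ k ≤ ε := fun D ε hε => by
    have := ((tendsto_pow_atTop_nhds_zero_of_lt_one hL0 hL1).const_mul D).eventually_lt_const
      (show D * 0 < ε by simpa)
    exact this.exists.imp fun _ h => le_of_lt h
  have hxc : IsCadlag x := by
    refine .of_forall_approx fun T ε hε => ?_
    obtain ⟨D, -, hD⟩ := hunif T
    obtain ⟨k, hk⟩ := hsmall D ε hε
    exact ⟨y k, hy k, fun t ht => by rw [abs_sub_comm]; exact (hD k t ht).trans hk⟩
  refine ⟨x, hxc, fun t => ?_⟩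
  obtain ⟨D, hD0, hD⟩ := hunif t
  refine tendsto_nhds_unique ((tendsto_add_atTop_iff_nat 1).2 (hx t)) ?_
  refine Tendsto.const_add _ (tendsto_iff_dist_tendsto_zero.2 ?_)
  refine squeeze_zero (fun _ => dist_nonneg) (fun k => ?_)
    (by simpa using (tendsto_pow_atTop_nhds_zero_of_lt_one hL0 hL1).const_mul D)
  rw [Real.dist_eq]
  refine (abs_stieltjesConv_sub_le (hy k).max_sub_one hxc.max_sub_one
    (κ := D * L ^ k) (M := 0) (by positivity) le_rfl fun s hs => ?_).trans (by simp)
  refine (abs_max_sub_zero_sub_le _ _ _ _).trans ?_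
  simpa using hD k s hs

end Volterra

theorem isFluidSolution_iff {F Ft : Measure ℝ≥0} {q₀ : ℝ} {e q : ℝ≥0 → ℝ} :
    IsFluidSolution F Ft q₀ e q ↔ IsCadlag q ∧ ∀ t, q t =
    (q₀ - max (q₀ - 1) 0 * F.real (Set.Iic t) - min q₀ 1 * Ft.real (Set.Iic t) + e t
      - stieltjesConv F e t) + stieltjesConv F (fun s => max (q s - 1) 0) t :=
  ⟨fun h => ⟨h.cadlag, h.eq⟩, fun h => ⟨h.1, h.2⟩⟩

section Fluid

variable {F Ft : Measure ℝ≥0} [IsProbabilityMeasure F] {q₀ : ℝ} {e q : ℝ≥0 → ℝ}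

theorem isCadlag_fluidEntrance (he : IsCadlag e) (hq : IsCadlag q) :
    IsCadlag (fluidEntrance q₀ e q) :=
  ((IsCadlag.of_continuous continuous_const).add he).sub hq.max_sub_one

theorem IsFluidSolution.eq_fluidEntrance (h : IsFluidSolution F Ft q₀ e q) (he : IsCadlag e)
    (t : ℝ≥0) : q t = max (q₀ - 1) 0 + min q₀ 1 * (1 - Ft.real (Set.Iic t)) + e t
      - stieltjesConv F (fluidEntrance q₀ e q) t := by
  have h1 : stieltjesConv F (fluidEntrance q₀ e q) t
      = max (q₀ - 1) 0 * F.real (Set.Iic t) + stieltjesConv F e t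
        - stieltjesConv F (fun s => max (q s - 1) 0) t := by
    have hc := IsCadlag.of_continuous (continuous_const (y := max (q₀ - 1) 0))
    rw [← stieltjesConv_const, ← stieltjesConv_add hc he,
      ← stieltjesConv_sub (hc.add he) h.cadlag.max_sub_one]
    rfl
  have h2 : max (q₀ - 1) 0 + min q₀ 1 = q₀ := by
    rcases le_total q₀ 1 with h | h
    · rw [max_eq_right (by linarith), min_eq_left h]; ring
    · rw [max_eq_left (by linarith), min_eq_right h]; ring
  rw [h1, (isFluidSolution_iff.1 h).2 t]
  linarith

theorem exists_isFluidSolution [IsProbabilityMeasure Ft] (hF : F.real (Set.Iic 0) < 1)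
    (he : IsCadlag e) : ∃ q, IsFluidSolution F Ft q₀ e q := by
  obtain ⟨q, hq, hqe⟩ := exists_volterra_solution hF
    (z := fun t => q₀ - max (q₀ - 1) 0 * F.real (Set.Iic t) - min q₀ 1 * Ft.real (Set.Iic t)
      + e t - stieltjesConv F e t)
    (((((IsCadlag.of_continuous continuous_const).sub
      ((isCadlag_real_Iic F).const_mul _)).sub ((isCadlag_real_Iic Ft).const_mul _)).add he).sub
      he.stieltjesConv)
  exact ⟨q, isFluidSolution_iff.2 ⟨hq, hqe⟩⟩

/-- Stability of the fluid equation, with respect to the perturbation `κ` of its free term and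
the perturbation `κ'` of the entrance process. -/
theorem IsFluidSolution.abs_sub_le (hF : F.real (Set.Iic 0) < 1)
    (h : IsFluidSolution F Ft q₀ e q) (he : IsCadlag e) {x a r : ℝ≥0 → ℝ} {T : ℝ≥0} {κ κ' : ℝ}
    (hκ : 0 ≤ κ) (hκ' : 0 ≤ κ') (hx : IsCadlag x) (ha : IsCadlag a)
    (hxr : ∀ t ≤ T, x t = r t - stieltjesConv F a t)
    (hr : ∀ t ≤ T,
      |r t - (max (q₀ - 1) 0 + min q₀ 1 * (1 - Ft.real (Set.Iic t)) + e t)| ≤ κ)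
    (hae : ∀ t ≤ T, |a t - fluidEntrance q₀ e q t| ≤ κ' + |x t - q t|) :
    ∀ t ≤ T, |x t - q t| ≤ (κ + κ') / (1 - laplaceOne F) * Real.exp T := by
  obtain ⟨C, -, hC⟩ := (hx.sub h.cadlag).exists_bound T
  have hL1 := laplaceOne_lt_one hF
  have key := le_of_weighted_contraction (u := fun t => |x t - q t|) (T := T)
    (κ := κ + κ') hL1 (fun t _ => abs_nonneg _) (by positivity) hC (fun M hM hu t ht => by
      have h1 := abs_stieltjesConv_sub_le (F := F) ha (isCadlag_fluidEntrance he h.cadlag) hκ' hM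
        (t := t) (fun s hs => by
          have h2 := hae s (hs.trans ht)
          have h3 := hu s (hs.trans ht)
          linarith)
      have h4 := abs_le.1 (hr t ht)
      have h5 := abs_le.1 h1
      have h6 := h.eq_fluidEntrance he t
      have h7 := hxr t ht
      rw [abs_le]
      constructor <;> linarith [h4.1, h4.2, h5.1, h5.2])
  intro t ht
  refine (key t ht).trans ?_
  have : Real.exp t ≤ Real.exp T := Real.exp_le_exp.2 (by exact_mod_cast ht)
  have hpos : 0 < 1 - laplaceOne F := by linarith
  gcongr

theorem IsFluidSolution.unique (hF : F.real (Set.Iic 0) < 1) (he : IsCadlag e)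
    (h : IsFluidSolution F Ft q₀ e q) {q' : ℝ≥0 → ℝ} (h' : IsFluidSolution F Ft q₀ e q') :
    q' = q := by
  funext t
  have := h.abs_sub_le hF he (x := q') (a := fluidEntrance q₀ e q') (T := t)
    le_rfl le_rfl h'.cadlag (isCadlag_fluidEntrance he h'.cadlag)
    (fun s _ => h'.eq_fluidEntrance he s) (fun s _ => by simp) (fun s _ => by
      have := abs_max_sub_zero_sub_le (q' s) (q s) 1 1
      rw [abs_sub_comm] at this
      simpa [fluidEntrance] using this) t le_rfl
  simpa [sub_eq_zero] using this

end Fluid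

/-- The events `p n` hold with (outer) probability tending to one. -/
def HoldsWHP {Ω : Type*} [MeasurableSpace Ω] (P : Measure Ω) (p : ℕ → Ω → Prop) : Prop :=
  Tendsto (fun n => P {ω | ¬ p n ω}) atTop (𝓝 0)

namespace HoldsWHP

variable {Ω : Type*} [MeasurableSpace Ω] {P : Measure Ω} {p q : ℕ → Ω → Prop}

theorem mono (hp : HoldsWHP P p) (h : ∀ᶠ n in atTop, ∀ ω, p n ω → q n ω) : HoldsWHP P q := by
  refine tendsto_of_tendsto_of_tendsto_of_le_of_le' tendsto_const_nhds hp
    (.of_forall fun _ => zero_le) ?_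
  filter_upwards [h] with n hn
  exact measure_mono fun ω hω hpω => hω (hn ω hpω)

theorem and (hp : HoldsWHP P p) (hq : HoldsWHP P q) :
    HoldsWHP P fun n ω => p n ω ∧ q n ω := by
  have h : Tendsto (fun n => P {ω | ¬ p n ω} + P {ω | ¬ q n ω}) atTop (𝓝 0) := by
    simpa using Tendsto.add hp hq
  refine tendsto_of_tendsto_of_tendsto_of_le_of_le tendsto_const_nhds h
    (fun _ => zero_le) fun n => (measure_mono fun ω hω => ?_).trans (measure_union_le _ _)
  exact not_and_or.1 hω

theorem of_eventually (h : ∀ᶠ n in atTop, ∀ ω, p n ω) : HoldsWHP P p := by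
  refine tendsto_const_nhds.congr' ?_
  filter_upwards [h] with n hn
  simp [hn]

theorem finset_forall {ι : Type*} (s : Finset ι) {p : ι → ℕ → Ω → Prop}
    (h : ∀ i ∈ s, HoldsWHP P (p i)) : HoldsWHP P fun n ω => ∀ i ∈ s, p i n ω := by
  classical
  induction s using Finset.induction_on with
  | empty => exact of_eventually (by simp)
  | insert i s _ ih =>
    simp only [Finset.forall_mem_insert] at h ⊢
    exact h.1.and (ih h.2)

theorem comp_tendsto (hp : HoldsWHP P p) {k : ℕ → ℕ} (hk : Tendsto k atTop atTop) :
    HoldsWHP P fun n => p (k n) :=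
  Tendsto.comp (g := fun n => P {ω | ¬ p n ω}) hp hk

end HoldsWHP

theorem tendstoUCP_iff {Ω : Type*} [MeasurableSpace Ω] {P : Measure Ω}
    {X : ℕ → ℝ≥0 → Ω → ℝ} {x : ℝ≥0 → ℝ} :
    TendstoUCP P X x ↔ ∀ T : ℝ≥0, 0 < T → ∀ ε : ℝ, 0 < ε →
      HoldsWHP P fun n ω => ∀ t ≤ T, |X n t ω - x t| ≤ ε := by
  have h : ∀ (T : ℝ≥0) (ε : ℝ), 0 < ε → ∀ n,
      {ω | ENNReal.ofReal ε < ⨆ t ∈ Set.Icc 0 T, ‖X n t ω - x t‖ₑ}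
        = {ω | ¬ ∀ t ≤ T, |X n t ω - x t| ≤ ε} := fun T ε hε n => by
    ext ω
    simp only [Set.mem_ofPred_eq, ← not_le, iSup₂_le_iff, Real.enorm_eq_ofReal_abs,
      ENNReal.ofReal_le_ofReal_iff hε.le, Set.mem_Icc, zero_le, true_and]
  refine forall₄_congr fun T _ ε hε => ?_
  simp only [HoldsWHP, h T ε hε]

section EmpiricalMeasure

theorem exists_measure_lt_of_antitone {α : Type*} [MeasurableSpace α] {μ : Measure α}
    [IsFiniteMeasure μ] {s : ℕ → Set α} (hs : ∀ n, MeasurableSet (s n)) (hanti : Antitone s)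
    (hempty : ⋂ n, s n = ∅) {ε : ℝ≥0∞} (hε : 0 < ε) : ∃ n, μ (s n) < ε := by
  have h := tendsto_measure_iInter_atTop (μ := μ) (fun n => (hs n).nullMeasurableSet) hanti
    ⟨0, measure_ne_top _ _⟩
  rw [hempty, measure_empty] at h
  exact (h.eventually_lt_const hε).exists

/-- Brackets for the half-lines `Iic x`, for any precision `δ`. -/
theorem exists_finite_brackets (F : Measure ℝ≥0) [IsProbabilityMeasure F] {δ : ℝ} (hδ : 0 < δ) :
    ∃ S : Finset (Set ℝ≥0), (∀ B ∈ S, MeasurableSet B) ∧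
      ∀ x, ∃ B₁ ∈ S, ∃ B₂ ∈ S, B₁ ⊆ Set.Iic x ∧ Set.Iic x ⊆ B₂ ∧ F.real B₂ ≤ F.real B₁ + δ := by
  classical
  have hδ' : (0 : ℝ≥0∞) < ENNReal.ofReal δ := by simpa
  have hdiff : ∀ B₁ B₂ D : Set ℝ≥0, B₂ ⊆ B₁ ∪ D → F D < ENNReal.ofReal δ →
      F.real B₂ ≤ F.real B₁ + δ := fun B₁ B₂ D h hD => by
    refine (measureReal_mono h).trans ((measureReal_union_le _ _).trans ?_)
    gcongr
    exact ENNReal.toReal_le_of_le_ofReal hδ.le hD.le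
  obtain ⟨R, hR⟩ : ∃ R : ℝ≥0, F (Set.Ioi R) < ENNReal.ofReal δ := by
    have hempty : ⋂ n : ℕ, Set.Ioi (n : ℝ≥0) = ∅ := by
      refine Set.eq_empty_of_forall_notMem fun x hx => ?_
      obtain ⟨n, hn⟩ := exists_nat_gt x
      exact lt_asymm hn (Set.mem_iInter.1 hx n)
    obtain ⟨n, hn⟩ := exists_measure_lt_of_antitone (μ := F) (fun _ => measurableSet_Ioi)
      (fun m n h => Set.Ioi_subset_Ioi (by exact_mod_cast h)) hempty hδ'
    exact ⟨n, hn⟩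
  obtain ⟨S, hS, hSR⟩ : ∃ S : Finset (Set ℝ≥0), (∀ B ∈ S, MeasurableSet B) ∧
      ∀ x ∈ Set.Icc 0 R, ∃ B₁ ∈ S, ∃ B₂ ∈ S,
        B₁ ⊆ Set.Iic x ∧ Set.Iic x ⊆ B₂ ∧ F.real B₂ ≤ F.real B₁ + δ := by
    refine isCompact_Icc.induction_on
      (p := fun U => ∃ S : Finset (Set ℝ≥0), (∀ B ∈ S, MeasurableSet B) ∧
        ∀ x ∈ U, ∃ B₁ ∈ S, ∃ B₂ ∈ S,
          B₁ ⊆ Set.Iic x ∧ Set.Iic x ⊆ B₂ ∧ F.real B₂ ≤ F.real B₁ + δ)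
      ⟨∅, by simp, by simp⟩ ?_ ?_ fun x _ => ?_
    · rintro U V hUV ⟨S, hS, h⟩
      exact ⟨S, hS, fun x hx => h x (hUV hx)⟩
    · rintro U V ⟨S, hS, h⟩ ⟨S', hS', h'⟩
      refine ⟨S ∪ S', fun B hB => (Finset.mem_union.1 hB).elim (hS B) (hS' B), ?_⟩
      rintro x (hx | hx)
      · obtain ⟨B₁, h1, B₂, h2, h3⟩ := h x hx
        exact ⟨B₁, Finset.mem_union_left _ h1, B₂, Finset.mem_union_left _ h2, h3⟩
      · obtain ⟨B₁, h1, B₂, h2, h3⟩ := h' x hx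
        exact ⟨B₁, Finset.mem_union_right _ h1, B₂, Finset.mem_union_right _ h2, h3⟩
    · obtain ⟨v, hxv, hv⟩ : ∃ v > x, F (Set.Ioo x v) < ENNReal.ofReal δ := by
        obtain ⟨w, hw, hxw, hwx⟩ := exists_seq_strictAnti_tendsto x
        have hempty : ⋂ n, Set.Ioo x (w n) = ∅ := by
          refine Set.eq_empty_of_forall_notMem fun z hz => ?_
          obtain ⟨n, hn⟩ := (hwx.eventually_lt_const (Set.mem_iInter.1 hz 0).1).exists
          exact lt_asymm hn (Set.mem_iInter.1 hz n).2
        obtain ⟨n, hn⟩ := exists_measure_lt_of_antitone (μ := F) (fun _ => measurableSet_Ioo)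
          (fun m n h => Set.Ioo_subset_Ioo_right (hw.antitone h)) hempty hδ'
        exact ⟨w n, hxw n, hn⟩
      obtain ⟨U, hU, hUS⟩ : ∃ U ∈ 𝓝[<] x, ∃ S : Finset (Set ℝ≥0), (∀ B ∈ S, MeasurableSet B) ∧
          ∀ y ∈ U, ∃ B₁ ∈ S, ∃ B₂ ∈ S,
            B₁ ⊆ Set.Iic y ∧ Set.Iic y ⊆ B₂ ∧ F.real B₂ ≤ F.real B₁ + δ := by
        rcases eq_zero_or_pos x with rfl | hx
        · refine ⟨∅, ?_, ∅, by simp, by simp⟩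
          simp
        · obtain ⟨u, hux, hu⟩ : ∃ u < x, F (Set.Ioo u x) < ENNReal.ofReal δ := by
            obtain ⟨w, hw, hxw, hwx⟩ := exists_seq_strictMono_tendsto' hx
            have hempty : ⋂ n, Set.Ioo (w n) x = ∅ := by
              refine Set.eq_empty_of_forall_notMem fun z hz => ?_
              obtain ⟨n, hn⟩ := (hwx.eventually_const_lt (Set.mem_iInter.1 hz 0).2).exists
              exact lt_asymm hn (Set.mem_iInter.1 hz n).1
            obtain ⟨n, hn⟩ := exists_measure_lt_of_antitone (μ := F) (fun _ => measurableSet_Ioo)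
              (fun m n h => Set.Ioo_subset_Ioo_left (hw.monotone h)) hempty hδ'
            exact ⟨w n, (hxw n).2, hn⟩
          refine ⟨Set.Ioo u x, Ioo_mem_nhdsLT hux, {Set.Iic u, Set.Iio x}, ?_, fun y hy => ?_⟩
          · simp [measurableSet_Iic, measurableSet_Iio]
          · refine ⟨Set.Iic u, by simp, Set.Iio x, by simp, Set.Iic_subset_Iic.2 hy.1.le,
              fun z hz => lt_of_le_of_lt hz hy.2, hdiff _ _ (Set.Ioo u x) ?_ hu⟩
            intro z hz
            exact (le_or_gt z u).imp id fun h => ⟨h, hz⟩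
      obtain ⟨S, hS, hSU⟩ := hUS
      refine ⟨U ∪ Set.Ico x v, ?_, S ∪ {Set.Iic x, Set.Iio v}, ?_, ?_⟩
      · refine mem_nhdsWithin_of_mem_nhds ?_
        rw [← nhdsLT_sup_nhdsGE]
        exact ⟨mem_of_superset hU Set.subset_union_left,
          mem_of_superset (Ico_mem_nhdsGE hxv) Set.subset_union_right⟩
      · intro B hB
        simp only [Finset.mem_union, Finset.mem_insert, Finset.mem_singleton] at hB
        rcases hB with hB | rfl | rfl
        exacts [hS B hB, measurableSet_Iic, measurableSet_Iio]
      · rintro y (hy | hy)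
        · obtain ⟨B₁, h1, B₂, h2, h3⟩ := hSU y hy
          exact ⟨B₁, Finset.mem_union_left _ h1, B₂, Finset.mem_union_left _ h2, h3⟩
        · refine ⟨Set.Iic x, by simp, Set.Iio v, by simp, Set.Iic_subset_Iic.2 hy.1,
            fun z hz => lt_of_le_of_lt hz hy.2, hdiff _ _ (Set.Ioo x v) ?_ hv⟩
          intro z hz
          exact (le_or_gt z x).imp id fun h => ⟨h, hz⟩
  refine ⟨S ∪ {Set.Iic R, Set.univ}, ?_, fun x => ?_⟩
  · intro B hB
    simp only [Finset.mem_union, Finset.mem_insert, Finset.mem_singleton] at hB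
    rcases hB with hB | rfl | rfl
    exacts [hS B hB, measurableSet_Iic, MeasurableSet.univ]
  · rcases le_or_gt x R with hx | hx
    · obtain ⟨B₁, h1, B₂, h2, h3⟩ := hSR x ⟨zero_le, hx⟩
      exact ⟨B₁, Finset.mem_union_left _ h1, B₂, Finset.mem_union_left _ h2, h3⟩
    · refine ⟨Set.Iic R, by simp, Set.univ, by simp, Set.Iic_subset_Iic.2 hx.le,
        Set.subset_univ _, hdiff _ _ (Set.Ioi R) ?_ hR⟩
      exact fun z _ => le_or_gt z R

variable {Ω : Type*} [MeasurableSpace Ω] {P : Measure Ω} [IsProbabilityMeasure P]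
  {F : Measure ℝ≥0} {η : ℕ → Ω → ℝ≥0}

/-- The weak law of large numbers for the frequency of `B`. -/
theorem holdsWHP_frequency (hη : ∀ i, Measurable (η i)) (hη_law : ∀ i, P.map (η i) = F)
    (hη_indep : iIndepFun η P) {B : Set ℝ≥0} (hB : MeasurableSet B) {δ : ℝ} (hδ : 0 < δ) :
    HoldsWHP P fun m ω =>
      |∑ i ∈ Finset.range m, (B.indicator 1 (η i ω) - F.real B)| ≤ δ * m := by
  have hBm : Measurable (B.indicator (1 : ℝ≥0 → ℝ)) := measurable_one.indicator hB
  let X : ℕ → Ω → ℝ := fun i => B.indicator (1 : ℝ≥0 → ℝ) ∘ η i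
  have hX : ∀ i, Measurable (X i) := fun i => hBm.comp (hη i)
  have hint : Integrable (X 0) P := by
    refine Integrable.of_bound (hX 0).aestronglyMeasurable 1 (.of_forall fun ω => ?_)
    refine (norm_indicator_le_norm_self _ _).trans (by simp)
  have hmean : ∫ ω, X 0 ω ∂P = F.real B := by
    rw [← hη_law 0, ← integral_indicator_one hB,
      integral_map (hη 0).aemeasurable hBm.aestronglyMeasurable]
    rfl
  have hslln := strong_law_ae_real X hint
    (fun i j hij => (hη_indep.indepFun hij).comp hBm hBm)
    (fun i => IdentDistrib.comp ⟨(hη i).aemeasurable, (hη 0).aemeasurable,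
      (hη_law i).trans (hη_law 0).symm⟩ hBm)
  have hmeas := tendstoInMeasure_of_tendsto_ae (μ := P)
    (f := fun (n : ℕ) ω => (∑ i ∈ Finset.range n, X i ω) / n) (g := fun _ => ∫ ω, X 0 ω ∂P)
    (fun n => ((Finset.measurable_sum _ fun i _ => hX i).div_const _).aestronglyMeasurable) hslln
  have h := hmeas (ENNReal.ofReal δ) (by simpa)
  have h' : HoldsWHP P fun m ω => |(∑ i ∈ Finset.range m, X i ω) / m - F.real B| < δ := by
    refine h.congr fun n => ?_
    congr 1
    ext ω
    simp only [Set.mem_ofPred_eq, hmean, edist_dist, Real.dist_eq, not_lt]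
    rw [ENNReal.ofReal_le_ofReal_iff (abs_nonneg _)]
  refine h'.mono ?_
  filter_upwards [eventually_gt_atTop 0] with m hm ω hω
  have hm' : (0 : ℝ) < m := by exact_mod_cast hm
  have h2 : ∑ i ∈ Finset.range m, (B.indicator 1 (η i ω) - F.real B)
      = ((∑ i ∈ Finset.range m, X i ω) / m - F.real B) * m := by
    rw [Finset.sum_sub_distrib, sub_mul, div_mul_cancel₀ _ hm'.ne']
    simp [X, mul_comm]
  rw [h2, abs_mul, abs_of_pos hm']
  gcongr

/-- A weak uniform law of large numbers over half-lines, in each of the first `K` blocks of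
length `b`. -/
theorem holdsWHP_block_frequency [IsProbabilityMeasure F] (hη : ∀ i, Measurable (η i))
    (hη_law : ∀ i, P.map (η i) = F) (hη_indep : iIndepFun η P) {b : ℕ → ℕ} (hb : Tendsto b atTop atTop) (K : ℕ)
    {δ : ℝ} (hδ : 0 < δ) :
    HoldsWHP P fun n ω => ∀ j < K, ∀ x,
      |∑ i ∈ Finset.Ico (j * b n) ((j + 1) * b n),
        ((Set.Iic x).indicator 1 (η i ω) - F.real (Set.Iic x))| ≤ δ * b n := by
  obtain ⟨S, hS, hbr⟩ := exists_finite_brackets F (half_pos hδ)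
  set δ' : ℝ := δ / 2 / (2 * K + 1) with hδ'
  have hδ'0 : 0 < δ' := by positivity
  have h1 : HoldsWHP P fun n ω => ∀ B ∈ S, ∀ j ∈ Finset.range (K + 1),
      |∑ i ∈ Finset.range (j * b n), (B.indicator 1 (η i ω) - F.real B)|
        ≤ δ' * (j * b n : ℕ) := by
    refine HoldsWHP.finset_forall _ fun B hB => HoldsWHP.finset_forall _ fun j _ => ?_
    rcases Nat.eq_zero_or_pos j with rfl | hj
    · exact .of_eventually (by simp)
    · exact (holdsWHP_frequency hη hη_law hη_indep (hS B hB) hδ'0).comp_tendsto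
        (tendsto_atTop_mono (fun n => Nat.le_mul_of_pos_left _ hj) hb)
  refine h1.mono (.of_forall fun n ω h j hj x => ?_)
  have hblock : ∀ B ∈ S, |∑ i ∈ Finset.Ico (j * b n) ((j + 1) * b n),
      (B.indicator 1 (η i ω) - F.real B)| ≤ δ / 2 * b n := fun B hB => by
    have a1 := h B hB j (Finset.mem_range.2 (by omega))
    have a2 := h B hB (j + 1) (Finset.mem_range.2 (by omega))
    rw [Finset.sum_Ico_eq_sub _ (Nat.mul_le_mul_right _ (Nat.le_succ j))]
    refine (abs_sub _ _).trans ((add_le_add a2 a1).trans ?_)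
    have hjK : (j : ℝ) + 1 ≤ K := by exact_mod_cast hj
    have hb0 : (0 : ℝ) ≤ b n := Nat.cast_nonneg _
    have e1 : δ / 2 = δ' * (2 * K + 1) := by rw [hδ']; field_simp
    rw [e1]
    push_cast
    have : δ' * b n * (2 * j + 1) ≤ δ' * b n * (2 * K + 1) := by gcongr
    nlinarith
  obtain ⟨B₁, hB₁, B₂, hB₂, hs₁, hs₂, hle⟩ := hbr x
  have c1 := abs_le.1 (hblock B₁ hB₁)
  have c2 := abs_le.1 (hblock B₂ hB₂)
  have hm1 : F.real B₁ ≤ F.real (Set.Iic x) := measureReal_mono hs₁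
  have hm2 : F.real (Set.Iic x) ≤ F.real B₂ := measureReal_mono hs₂
  have s1 : ∑ i ∈ Finset.Ico (j * b n) ((j + 1) * b n), B₁.indicator (1 : ℝ≥0 → ℝ) (η i ω)
      ≤ ∑ i ∈ Finset.Ico (j * b n) ((j + 1) * b n),
        (Set.Iic x).indicator (1 : ℝ≥0 → ℝ) (η i ω) :=
    Finset.sum_le_sum fun i _ => Set.indicator_le_indicator_of_subset hs₁ (fun _ => zero_le_one) _
  have s2 : ∑ i ∈ Finset.Ico (j * b n) ((j + 1) * b n), (Set.Iic x).indicator (1 : ℝ≥0 → ℝ) (η i ω)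
      ≤ ∑ i ∈ Finset.Ico (j * b n) ((j + 1) * b n), B₂.indicator (1 : ℝ≥0 → ℝ) (η i ω) :=
    Finset.sum_le_sum fun i _ => Set.indicator_le_indicator_of_subset hs₂ (fun _ => zero_le_one) _
  have hcard : (j + 1) * b n - j * b n = b n := by
    rw [add_mul, one_mul, Nat.add_sub_cancel_left]
  simp only [Finset.sum_sub_distrib, Finset.sum_const, Nat.card_Ico, hcard, nsmul_eq_mul] at c1 c2 ⊢
  have hb0 : (0 : ℝ) ≤ b n := Nat.cast_nonneg _
  have m1 := mul_le_mul_of_nonneg_left hm1 hb0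
  have m2 := mul_le_mul_of_nonneg_left hm2 hb0
  have m3 := mul_le_mul_of_nonneg_left hle hb0
  rw [abs_le]
  constructor <;> nlinarith [c1.1, c1.2, c2.1, c2.2]

end EmpiricalMeasure

/-- Deterministic comparison: when the frequencies of half-lines are close to `F` in each block of
length `b`, they can be evaluated along any decreasing sequence of half-lines. -/
theorem abs_sum_antitone_le {F : Measure ℝ≥0} [IsProbabilityMeasure F] {y : ℕ → ℝ≥0}
    {S : ℕ → Set ℝ≥0} (hS : Antitone S) (hSx : ∀ i, S i = ∅ ∨ ∃ x, S i = Set.Iic x)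
    {b K : ℕ} {δ : ℝ} (hδ : 0 ≤ δ)
    (h : ∀ j < K, ∀ x, |∑ i ∈ Finset.Ico (j * b) ((j + 1) * b),
        ((Set.Iic x).indicator 1 (y i) - F.real (Set.Iic x))| ≤ δ * b) :
    |∑ i ∈ Finset.range (K * b), ((S i).indicator 1 (y i) - F.real (S i))|
      ≤ (K * δ + 1) * b := by
  have hS' : ∀ j < K, ∀ k, |∑ i ∈ Finset.Ico (j * b) ((j + 1) * b),
      ((S k).indicator 1 (y i) - F.real (S k))| ≤ δ * b := by
    intro j hj k
    rcases hSx k with hk | ⟨x, hk⟩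
    · simp only [hk]
      simpa using by positivity
    · simp only [hk]; exact h j hj x
  have key : ∀ k ≤ K, |∑ i ∈ Finset.range (k * b), ((S i).indicator 1 (y i) - F.real (S i))|
      ≤ k * δ * b + b * (F.real (S 0) - F.real (S (k * b))) := by
    intro k
    induction k with
    | zero => simp
    | succ k ih =>
      intro hk
      have ih := abs_le.1 (ih (by omega))
      have d1 := abs_le.1 (hS' k (by omega) (k * b))
      have d2 := abs_le.1 (hS' k (by omega) ((k + 1) * b))
      have hcard : (k + 1) * b - k * b = b := by
        rw [add_mul, one_mul, Nat.add_sub_cancel_left]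
      rw [← Finset.sum_range_add_sum_Ico _ (Nat.mul_le_mul_right b (Nat.le_succ k))]
      simp only [Finset.sum_sub_distrib, Finset.sum_const, Nat.card_Ico, hcard, nsmul_eq_mul]
        at d1 d2
      have s1 : ∑ i ∈ Finset.Ico (k * b) ((k + 1) * b), ((S i).indicator (1 : ℝ≥0 → ℝ) (y i))
          ≤ ∑ i ∈ Finset.Ico (k * b) ((k + 1) * b), (S (k * b)).indicator (1 : ℝ≥0 → ℝ) (y i) :=
        Finset.sum_le_sum fun i hi => Set.indicator_le_indicator_of_subset
          (hS (Finset.mem_Ico.1 hi).1) (fun _ => zero_le_one) _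
      have s2 : ∑ i ∈ Finset.Ico (k * b) ((k + 1) * b),
            (S ((k + 1) * b)).indicator (1 : ℝ≥0 → ℝ) (y i)
          ≤ ∑ i ∈ Finset.Ico (k * b) ((k + 1) * b), ((S i).indicator (1 : ℝ≥0 → ℝ) (y i)) :=
        Finset.sum_le_sum fun i hi => Set.indicator_le_indicator_of_subset
          (hS (Finset.mem_Ico.1 hi).2.le) (fun _ => zero_le_one) _
      have s3 : ∑ i ∈ Finset.Ico (k * b) ((k + 1) * b), F.real (S i) ≤ b * F.real (S (k * b)) := by
        refine (Finset.sum_le_card_nsmul _ _ (F.real (S (k * b))) fun i hi =>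
          measureReal_mono (hS (Finset.mem_Ico.1 hi).1)).trans ?_
        simp [hcard]
      have s4 : b * F.real (S ((k + 1) * b))
          ≤ ∑ i ∈ Finset.Ico (k * b) ((k + 1) * b), F.real (S i) := by
        refine le_trans ?_ (Finset.card_nsmul_le_sum _ _ (F.real (S ((k + 1) * b))) fun i hi =>
          measureReal_mono (hS (Finset.mem_Ico.1 hi).2.le))
        simp [hcard]
      rw [Finset.sum_sub_distrib (s := Finset.Ico _ _), abs_le]
      push_cast
      constructor <;> linarith [ih.1, ih.2, d1.1, d1.2, d2.1, d2.2]
  refine (key K le_rfl).trans ?_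
  have h1 : F.real (S 0) ≤ 1 := measureReal_le_one
  have h2 : 0 ≤ F.real (S (K * b)) := measureReal_nonneg
  have hb0 : (0 : ℝ) ≤ b := Nat.cast_nonneg _
  nlinarith

section Departures

variable {A : ℝ≥0 → ℕ}

/-- The service times with which customer `i` has left by time `t`. -/
def departureSet (A : ℝ≥0 → ℕ) (t : ℝ≥0) (i : ℕ) : Set ℝ≥0 := {x | x ≤ t ∧ i < A (t - x)}

theorem antitone_departureSet (A : ℝ≥0 → ℕ) (t : ℝ≥0) : Antitone (departureSet A t) :=
  fun _ _ h _ hx => ⟨hx.1, lt_of_le_of_lt h hx.2⟩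

theorem mem_departureSet_iff (hA : Monotone A) (hA' : IsCadlag fun t => (A t : ℝ)) {t x : ℝ≥0}
    {i : ℕ} : x ∈ departureSet A t i ↔ i < A t ∧ entryTime A i + x ≤ t := by
  constructor
  · rintro ⟨hx, hi⟩
    exact ⟨lt_of_lt_of_le hi (hA tsub_le_self),
      (le_tsub_iff_right hx).1 ((le_iff_entryTime_le hA hA' i _).1 hi).2⟩
  · rintro ⟨hi, hx⟩
    have hxt : x ≤ t := le_trans le_add_self hx
    exact ⟨hxt, (le_iff_entryTime_le hA hA' i _).2 ⟨⟨t, hi⟩, (le_tsub_iff_right hxt).2 hx⟩⟩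

theorem departureSet_eq (hA : Monotone A) (hA' : IsCadlag fun t => (A t : ℝ)) (t : ℝ≥0) (i : ℕ) :
    departureSet A t i = ∅ ∨ ∃ x, departureSet A t i = Set.Iic x := by
  rcases le_or_gt (A t) i with hi | hi
  · left
    ext x
    simp [mem_departureSet_iff hA hA', hi]
  · right
    refine ⟨t - entryTime A i, ?_⟩
    ext x
    rw [mem_departureSet_iff hA hA', Set.mem_Iic,
      le_tsub_iff_left ((le_iff_entryTime_le hA hA' i t).1 hi).2]
    simp [hi]

theorem measurableSet_departureSet (hA : Monotone A) (hA' : IsCadlag fun t => (A t : ℝ))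
    (t : ℝ≥0) (i : ℕ) : MeasurableSet (departureSet A t i) := by
  rcases departureSet_eq hA hA' t i with h | ⟨x, h⟩
  · simp [h]
  · simp [h]

theorem departures_eq_sum_indicator (hA : Monotone A) (hA' : IsCadlag fun t => (A t : ℝ))
    (y : ℕ → ℝ≥0) {t : ℝ≥0} {N : ℕ} (hN : A t ≤ N) :
    departures A y t = ∑ i ∈ Finset.range N, (departureSet A t i).indicator 1 (y i) := by
  classical
  rw [departures_eq_sum hA hA',
    ← Finset.sum_subset (Finset.range_subset_range.2 hN) (fun i _ hi => ?_)]
  · refine Finset.sum_congr rfl fun i hi => ?_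
    simp [Set.indicator_apply, mem_departureSet_iff hA hA', Finset.mem_range.1 hi]
  · refine Set.indicator_of_notMem (fun h => hi ?_) _
    exact Finset.mem_range.2 ((mem_departureSet_iff hA hA').1 h).1

theorem stieltjesConv_eq_sum (F : Measure ℝ≥0) [IsProbabilityMeasure F] (hA : Monotone A)
    (hA' : IsCadlag fun t => (A t : ℝ)) {t : ℝ≥0} {N : ℕ} (hN : A t ≤ N) :
    stieltjesConv F (fun s => (A s : ℝ)) t
      = ∑ i ∈ Finset.range N, F.real (departureSet A t i) := by
  classical
  have h : ∀ s, (Set.Icc 0 t).indicator (fun s => (A (t - s) : ℝ)) s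
      = ∑ i ∈ Finset.range N, (departureSet A t i).indicator (1 : ℝ≥0 → ℝ) s := by
    intro s
    by_cases hs : s ≤ t
    · have h1 : A (t - s) ≤ N := (hA tsub_le_self).trans hN
      have h2 : (Finset.range N).filter (fun i => i < A (t - s)) = Finset.range (A (t - s)) := by
        ext i; simp only [Finset.mem_filter, Finset.mem_range]; omega
      simp [Set.indicator_apply, departureSet, hs, Finset.sum_boole, h2]
    · simp [departureSet, hs]
  rw [stieltjesConv, ← integral_indicator measurableSet_Icc, integral_congr_ae (.of_forall h),
    integral_finsetSum]
  · exact Finset.sum_congr rfl fun i _ =>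
      integral_indicator_one (measurableSet_departureSet hA hA' t i)
  · exact fun i _ => (integrable_const (1 : ℝ)).indicator (measurableSet_departureSet hA hA' t i)

end Departures

/-- The number of departures is uniformly close to its compensation `A ∗ F`, whatever the
entrance process is. -/
theorem holdsWHP_departures {Ω : Type*} [MeasurableSpace Ω] {P : Measure Ω}
    [IsProbabilityMeasure P] {F : Measure ℝ≥0} [IsProbabilityMeasure F] {η : ℕ → Ω → ℝ≥0}
    (hη : ∀ i, Measurable (η i)) (hη_law : ∀ i, P.map (η i) = F) (hη_indep : iIndepFun η P)
    (M : ℝ) {ε : ℝ} (hε : 0 < ε) :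
    HoldsWHP P fun n ω => ∀ A : ℝ≥0 → ℕ, Monotone A → (IsCadlag fun t => (A t : ℝ)) → ∀ t,
      (A t : ℝ) ≤ M * n →
      |departures A (fun i => η i ω) t - stieltjesConv F (fun s => (A s : ℝ)) t| ≤ ε * n := by
  set δ := ε / 4 with hδ
  have hδ0 : 0 < δ := by positivity
  let b : ℕ → ℕ := fun n => ⌈δ * n⌉₊
  have hb : Tendsto b atTop atTop :=
    tendsto_nat_ceil_atTop.comp (tendsto_natCast_atTop_atTop.const_mul_atTop hδ0)
  set K : ℕ := ⌈M / δ⌉₊ + 1 with hK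
  have hK0 : (0 : ℝ) < K := by positivity
  have hKM : M ≤ K * δ := by
    rw [← div_le_iff₀ hδ0, hK]
    push_cast
    linarith [Nat.le_ceil (M / δ)]
  refine (holdsWHP_block_frequency hη hη_law hη_indep hb K (inv_pos.2 hK0)).mono ?_
  have hlarge : ∀ᶠ n : ℕ in atTop, 1 ≤ δ * n :=
    (tendsto_natCast_atTop_atTop.const_mul_atTop hδ0).eventually_ge_atTop 1
  filter_upwards [hlarge] with n hn ω h A hA hA' t hAt
  have hb1 : δ * n ≤ b n := Nat.le_ceil _
  have hb2 : (b n : ℝ) < δ * n + 1 := Nat.ceil_lt_add_one (by positivity)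
  have hN : A t ≤ K * b n := by
    have : (A t : ℝ) ≤ K * b n := calc
      (A t : ℝ) ≤ M * n := hAt
      _ ≤ K * δ * n := by gcongr
      _ = K * (δ * n) := by ring
      _ ≤ K * b n := by gcongr
    exact_mod_cast this
  rw [departures_eq_sum_indicator hA hA' _ hN, stieltjesConv_eq_sum F hA hA' hN,
    ← Finset.sum_sub_distrib]
  refine (abs_sum_antitone_le (antitone_departureSet A t) (departureSet_eq hA hA' t)
    (inv_pos.2 hK0).le h).trans ?_
  rw [mul_inv_cancel₀ hK0.ne', show ε = 4 * δ by rw [hδ]; ring]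
  linarith

section Residual

theorem abs_sum_range_sub_sum_range_le {f : ℕ → ℝ} (hf : ∀ i, |f i| ≤ 1) (m k : ℕ) :
    |∑ i ∈ Finset.range m, f i - ∑ i ∈ Finset.range k, f i| ≤ |(m : ℝ) - k| := by
  wlog h : k ≤ m generalizing m k
  · rw [abs_sub_comm, abs_sub_comm (m : ℝ)]
    exact this k m (le_of_not_ge h)
  rw [← Finset.sum_Ico_eq_sub _ h, abs_of_nonneg (a := (m : ℝ) - k) (by simpa using h)]
  refine (Finset.abs_sum_le_sum_abs _ _).trans
    ((Finset.sum_le_card_nsmul _ _ 1 fun i _ => hf i).trans ?_)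
  simp [Nat.cast_sub h]

theorem empiricalCDF_mem_Icc (y : ℕ → ℝ≥0) (k : ℕ) (t : ℝ≥0) :
    empiricalCDF y k t ∈ Set.Icc 0 1 := by
  have h0 : (0 : ℝ) ≤ ∑ i ∈ Finset.range k, if y i ≤ t then (1 : ℝ) else 0 :=
    Finset.sum_nonneg fun i _ => by split_ifs <;> simp
  have h1 : (∑ i ∈ Finset.range k, if y i ≤ t then (1 : ℝ) else 0) ≤ k := by
    refine (Finset.sum_le_card_nsmul _ _ 1 fun i _ => by split_ifs <;> simp).trans (by simp)
  refine ⟨by unfold empiricalCDF; positivity, ?_⟩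
  rw [empiricalCDF, inv_mul_eq_div]
  exact div_le_one_of_le₀ h1 (Nat.cast_nonneg _)

theorem sum_lt_eq_mul_one_sub_empiricalCDF (y : ℕ → ℝ≥0) (k : ℕ) (t : ℝ≥0) :
    (∑ i ∈ Finset.range k, if t < y i then (1 : ℝ) else 0) = k * (1 - empiricalCDF y k t) := by
  rcases Nat.eq_zero_or_pos k with rfl | hk
  · simp
  have hk' : (k : ℝ) ≠ 0 := by positivity
  have h : ∀ i, (if t < y i then (1 : ℝ) else 0) = 1 - if y i ≤ t then 1 else 0 := fun i => by
    rcases le_or_gt (y i) t with h | h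
    · simp [h, not_lt.2 h]
    · simp [h, not_le.2 h]
  rw [empiricalCDF, mul_sub, mul_inv_cancel_left₀ hk']
  simp [h]

theorem holdsWHP_residualCount {Ω : Type*} [MeasurableSpace Ω] {P : Measure Ω}
    {ηt : ℕ → Ω → ℝ≥0} {Q₀ : ℕ → Ω → ℕ} {Ft : ℝ≥0 → ℝ} {q₀ : ℝ} (hq₀ : 0 ≤ q₀)
    (hQ₀_lim : ∀ ε : ℝ, 0 < ε → HoldsWHP P fun n ω => |(Q₀ n ω : ℝ) / n - q₀| ≤ ε)
    (hF_lim : TendstoUCP P (fun n t ω => empiricalCDF (fun i => ηt i ω) n t) Ft)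
    {T : ℝ≥0} (hT : 0 < T) {ε : ℝ} (hε : 0 < ε) :
    HoldsWHP P fun n ω => ∀ t ≤ T,
      |residualCount n (Q₀ n ω) (fun i => ηt i ω) t / n - min q₀ 1 * (1 - Ft t)| ≤ ε := by
  set p := min q₀ 1 with hp
  have hp0 : 0 ≤ p := le_min hq₀ zero_le_one
  have hp1 : p ≤ 1 := min_le_right _ _
  let k : ℕ → ℕ := fun n => ⌊p * n⌋₊
  have hcdf : HoldsWHP P fun n ω => ∀ t ≤ T,
      p * |empiricalCDF (fun i => ηt i ω) (k n) t - Ft t| ≤ ε / 4 := by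
    rcases hp0.eq_or_lt with h | h
    · refine .of_eventually (.of_forall fun n ω t _ => ?_)
      rw [← h]; simp; positivity
    · have hk : Tendsto k atTop atTop :=
        tendsto_nat_floor_atTop.comp (tendsto_natCast_atTop_atTop.const_mul_atTop h)
      refine ((tendstoUCP_iff.1 hF_lim T hT (ε / 4) (by positivity)).comp_tendsto hk).mono
        (.of_forall fun n ω hω t ht => ?_)
      exact (mul_le_of_le_one_left (abs_nonneg _) hp1).trans (hω t ht)
  have hlarge : ∀ᶠ n : ℕ in atTop, 4 / ε ≤ n :=
    tendsto_natCast_atTop_atTop.eventually_ge_atTop _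
  refine ((hQ₀_lim (ε / 4) (by positivity)).and hcdf).mono ?_
  filter_upwards [hlarge, eventually_gt_atTop 0] with n hn hn0 ω hω t ht
  obtain ⟨h1, h2⟩ := hω
  have hn' : (0 : ℝ) < n := by exact_mod_cast hn0
  have hinv : 1 / (n : ℝ) ≤ ε / 4 := by
    rw [div_le_iff₀ hε] at hn
    rw [div_le_iff₀ hn']
    linarith
  set G := empiricalCDF (fun i => ηt i ω) (k n) t with hG
  have hG01 : G ∈ Set.Icc (0 : ℝ) 1 := empiricalCDF_mem_Icc _ _ _
  have hm : |((min (Q₀ n ω) n : ℕ) : ℝ) / n - p| ≤ ε / 4 := by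
    have : ((min (Q₀ n ω) n : ℕ) : ℝ) / n = min ((Q₀ n ω : ℝ) / n) 1 := by
      rw [Nat.cast_min, ← min_div_div_right hn'.le, div_self hn'.ne']
    rw [this, hp]
    refine (abs_min_sub_min_le_max _ _ _ _).trans ?_
    simpa [hε.le] using h1
  have hk : |(k n : ℝ) / n - p| ≤ ε / 4 := by
    have k1 : (k n : ℝ) ≤ p * n := Nat.floor_le (by positivity)
    have k2 : p * n < k n + 1 := Nat.lt_floor_add_one _
    refine le_trans ?_ hinv
    have e1 : (k n : ℝ) / n - p = -((p * n - k n) / n) := by field_simp; ring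
    rw [e1, abs_neg, abs_of_nonneg (div_nonneg (by linarith) hn'.le)]
    gcongr
    linarith
  have hsum : |residualCount n (Q₀ n ω) (fun i => ηt i ω) t / n - (k n : ℝ) / n * (1 - G)|
      ≤ |((min (Q₀ n ω) n : ℕ) : ℝ) / n - (k n : ℝ) / n| := by
    have e1 : (k n : ℝ) / n * (1 - G) = k n * (1 - G) / n := by ring
    rw [e1, hG, ← sum_lt_eq_mul_one_sub_empiricalCDF, residualCount, ← sub_div, ← sub_div,
      abs_div, abs_div]
    refine div_le_div_of_nonneg_right ?_ (abs_nonneg _)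
    exact abs_sum_range_sub_sum_range_le (f := fun i => if t < ηt i ω then 1 else 0)
      (fun i => by split_ifs <;> simp) _ _
  have hmid : |((k n : ℝ) / n - p) * (1 - G)| ≤ ε / 4 := by
    rw [abs_mul]
    refine (mul_le_of_le_one_right (abs_nonneg _) ?_).trans hk
    rw [abs_le]
    constructor <;> linarith [hG01.1, hG01.2]
  have hlast : |p * (Ft t - G)| ≤ ε / 4 := by
    rw [abs_mul, abs_of_nonneg hp0, abs_sub_comm]
    exact h2 t ht
  have htri := abs_sub_le (((min (Q₀ n ω) n : ℕ) : ℝ) / n) p ((k n : ℝ) / n)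
  rw [abs_sub_comm p] at htri
  have hdecomp : residualCount n (Q₀ n ω) (fun i => ηt i ω) t / n - p * (1 - Ft t)
      = (residualCount n (Q₀ n ω) (fun i => ηt i ω) t / n - (k n : ℝ) / n * (1 - G))
        + ((k n : ℝ) / n - p) * (1 - G) + p * (Ft t - G) := by
    ring
  rw [hdecomp]
  refine (abs_add_three _ _ _).trans ?_
  linarith

end Residual

theorem max_sub_div_eq {a c : ℝ} (hc : 0 < c) : max (a - c) 0 / c = max (a / c - 1) 0 := by
  rw [← max_div_div_right hc.le, sub_div, div_self hc.ne', zero_div]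

theorem stieltjesConv_div_const (F : Measure ℝ≥0) (g : ℝ≥0 → ℝ) (c : ℝ) (t : ℝ≥0) :
    stieltjesConv F (fun s => g s / c) t = stieltjesConv F g t / c :=
  integral_div _ _

/-- Deterministic error bound for the scaled `n`-server queue in terms of the errors of its
data. -/
theorem IsQueueSolution.abs_sub_fluid_le {F Ft : Measure ℝ≥0} [IsProbabilityMeasure F]
    (hF : F.real (Set.Iic 0) < 1) {n Q₀ : ℕ} (hn : 0 < n) {ηt η : ℕ → ℝ≥0} {E Q A : ℝ≥0 → ℕ}
    (h : IsQueueSolution n Q₀ ηt η E Q A) {q₀ : ℝ} {e q : ℝ≥0 → ℝ} (he : IsCadlag e)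
    (hq : IsFluidSolution F Ft q₀ e q) {T : ℝ≥0} {δ : ℝ} (hδ : 0 ≤ δ)
    (hQ₀ : |(Q₀ : ℝ) / n - q₀| ≤ δ) (hE : ∀ t ≤ T, |(E t : ℝ) / n - e t| ≤ δ)
    (hR : ∀ t ≤ T,
      |residualCount n Q₀ ηt t / n - min q₀ 1 * (1 - Ft.real (Set.Iic t))| ≤ δ)
    (hD : ∀ t ≤ T, |departures A η t - stieltjesConv F (fun s => (A s : ℝ)) t| ≤ δ * n) :
    ∀ t ≤ T, |(Q t : ℝ) / n - q t| ≤ 6 * δ / (1 - laplaceOne F) * Real.exp T ∧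
      |(A t : ℝ) / n - fluidEntrance q₀ e q t|
        ≤ 2 * δ + 6 * δ / (1 - laplaceOne F) * Real.exp T := by
  have hn' : (0 : ℝ) < n := by exact_mod_cast hn
  have hQ₀' : |max ((Q₀ : ℝ) / n - 1) 0 - max (q₀ - 1) 0| ≤ δ :=
    (abs_max_sub_zero_sub_le _ _ _ _).trans (by simpa using hQ₀)
  have hA : ∀ t, (A t : ℝ) / n = max ((Q₀ : ℝ) / n - 1) 0 + E t / n - max ((Q t : ℝ) / n - 1) 0 :=
    fun t => by
      rw [h.eq_A t, sub_div, add_div, max_sub_div_eq hn', max_sub_div_eq hn']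
  have hAe : ∀ t ≤ T, |(A t : ℝ) / n - fluidEntrance q₀ e q t| ≤ 2 * δ + |(Q t : ℝ) / n - q t| := by
    intro t ht
    have h1 := abs_max_sub_zero_sub_le ((Q t : ℝ) / n) (q t) 1 1
    rw [sub_sub_sub_cancel_right] at h1
    have h2 := abs_le.1 h1
    have h3 := abs_le.1 hQ₀'
    have h4 := abs_le.1 (hE t ht)
    rw [hA t, fluidEntrance, abs_le]
    constructor <;> linarith [h2.1, h2.2, h3.1, h3.2, h4.1, h4.2]
  have key := hq.abs_sub_le hF he (x := fun t => (Q t : ℝ) / n) (a := fun t => (A t : ℝ) / n)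
    (r := fun t => max ((Q₀ : ℝ) / n - 1) 0 + residualCount n Q₀ ηt t / n + E t / n
      + (stieltjesConv F (fun s => (A s : ℝ) / n) t - departures A η t / n))
    (T := T) (κ := 4 * δ) (κ' := 2 * δ) (by positivity) (by positivity)
    (h.cadlag_Q.div_const _) (h.cadlag_A.div_const _)
    (fun t _ => by
      rw [h.eq_Q t, sub_div, add_div, add_div, max_sub_div_eq hn']
      ring)
    (fun t ht => by
      have h1 : |stieltjesConv F (fun s => (A s : ℝ) / n) t - departures A η t / n| ≤ δ := by
        rw [stieltjesConv_div_const, ← sub_div, abs_div, abs_of_pos hn', div_le_iff₀ hn',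
          abs_sub_comm]
        exact hD t ht
      have h1 := abs_le.1 h1
      have h2 := abs_le.1 (hR t ht)
      have h3 := abs_le.1 hQ₀'
      have h4 := abs_le.1 (hE t ht)
      rw [abs_le]
      constructor <;> linarith [h1.1, h1.2, h2.1, h2.2, h3.1, h3.2, h4.1, h4.2])
    hAe
  have h6 : 4 * δ + 2 * δ = 6 * δ := by ring
  rw [h6] at key
  exact fun t ht => ⟨key t ht, (hAe t ht).trans (by linarith [key t ht])⟩

theorem IsQueueSolution.entrances_le {n Q₀ : ℕ} (hn : 0 < n) {ηt η : ℕ → ℝ≥0} {E Q A : ℝ≥0 → ℕ}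
    (h : IsQueueSolution n Q₀ ηt η E Q A) {q₀ : ℝ} (hq₀ : 0 ≤ q₀) {e : ℝ≥0 → ℝ}
    (he : Monotone e) {T : ℝ≥0} {δ : ℝ} (hδ : 0 ≤ δ) (hQ₀ : |(Q₀ : ℝ) / n - q₀| ≤ δ)
    (hE : ∀ t ≤ T, |(E t : ℝ) / n - e t| ≤ δ) {t : ℝ≥0} (ht : t ≤ T) :
    (A t : ℝ) ≤ (q₀ + e T + 2 * δ) * n := by
  have hn' : (0 : ℝ) < n := by exact_mod_cast hn
  rw [← div_le_iff₀ hn', h.eq_A t, sub_div, add_div, max_sub_div_eq hn', max_sub_div_eq hn']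
  have h1 : max ((Q₀ : ℝ) / n - 1) 0 ≤ q₀ + δ :=
    max_le (by linarith [(abs_le.1 hQ₀).2]) (by positivity)
  have h2 : 0 ≤ max ((Q t : ℝ) / n - 1) 0 := le_max_right _ _
  linarith [(abs_le.1 (hE t ht)).2, he ht]

end

theorem theorem2p1 {Ω : Type*} [MeasurableSpace Ω] (P : Measure Ω) [IsProbabilityMeasure P]
    -- service times: i.i.d. nonnegative with law `F`, not a.s. zero
    (F : Measure ℝ≥0) [IsProbabilityMeasure F] (hF : F.real (Set.Iic 0) < 1)
    (η : ℕ → Ω → ℝ≥0) (hη : ∀ i, Measurable (η i)) (hη_law : ∀ i, P.map (η i) = F)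
    (hη_indep : iIndepFun η P)
    -- remaining service times of the customers in service at time `0-`
    (ηt : ℕ → Ω → ℝ≥0) (hηt : ∀ i, Measurable (ηt i))
    -- initial numbers of customers and arrival processes of the `n`-server queues
    (Q₀ : ℕ → Ω → ℕ) (hQ₀ : ∀ n, Measurable (Q₀ n))
    (E : ℕ → ℝ≥0 → Ω → ℕ) (hE : ∀ n t, Measurable (E n t))
    (hE_mono : ∀ n ω, Monotone fun t => E n t ω)
    (hE_cadlag : ∀ n ω, IsCadlag fun t => (E n t ω : ℝ))
    (h_indep : ∀ n, iIndep
      ![MeasurableSpace.comap (Q₀ n) inferInstance,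
        MeasurableSpace.comap (fun ω i => ηt i ω) inferInstance,
        MeasurableSpace.comap (fun ω i => η i ω) inferInstance,
        MeasurableSpace.comap (fun ω t => E n t ω) inferInstance] P)
    -- number of customers present and number of customers that have entered service
    (Q A : ℕ → ℝ≥0 → Ω → ℕ) (hQ : ∀ n t, Measurable (Q n t)) (hA : ∀ n t, Measurable (A n t))
    (h_queue : ∀ n, 1 ≤ n → ∀ ω, IsQueueSolution n (Q₀ n ω) (fun i => ηt i ω) (fun i => η i ω)
      (fun t => E n t ω) (fun t => Q n t ω) (fun t => A n t ω))
    -- data of the fluid limit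
    (Ft : Measure ℝ≥0) [IsProbabilityMeasure Ft] (q₀ : ℝ) (hq₀ : 0 ≤ q₀)
    (e : ℝ≥0 → ℝ) (he_mono : Monotone e) (he_cadlag : IsCadlag e)
    -- convergence of the initial conditions and of the arrivals
    (hQ₀_lim : ∀ ε : ℝ, 0 < ε →
      Tendsto (fun n : ℕ => P {ω | ε < |(Q₀ n ω : ℝ) / n - q₀|}) atTop (𝓝 0))
    (hF_lim : TendstoUCP P (fun n t ω => empiricalCDF (fun i => ηt i ω) n t)
      fun t => Ft.real (Set.Iic t))
    (hE_lim : TendstoUCP P (fun n t ω => (E n t ω : ℝ) / n) e) :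
    ∃ q : ℝ≥0 → ℝ, IsFluidSolution F Ft q₀ e q ∧
      (∀ q' : ℝ≥0 → ℝ, IsFluidSolution F Ft q₀ e q' → q' = q) ∧
      TendstoUCP P (fun n t ω => (Q n t ω : ℝ) / n) q ∧
      TendstoUCP P (fun n t ω => (A n t ω : ℝ) / n) (fluidEntrance q₀ e q) := by
  obtain ⟨q, hq⟩ := exists_isFluidSolution (Ft := Ft) (q₀ := q₀) hF he_cadlag
  have hQ₀_whp : ∀ ε : ℝ, 0 < ε → HoldsWHP P fun n ω => |(Q₀ n ω : ℝ) / n - q₀| ≤ ε := by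
    intro ε hε
    simpa only [HoldsWHP, not_le] using hQ₀_lim ε hε
  have key : ∀ T : ℝ≥0, 0 < T → ∀ ε : ℝ, 0 < ε → HoldsWHP P fun n ω => ∀ t ≤ T,
      |(Q n t ω : ℝ) / n - q t| ≤ ε ∧ |(A n t ω : ℝ) / n - fluidEntrance q₀ e q t| ≤ ε := by
    intro T hT ε hε
    have hL : 0 < 1 - laplaceOne F := by linarith [laplaceOne_lt_one hF]
    set c := 6 / (1 - laplaceOne F) * Real.exp T with hc
    have hc0 : 0 < c := by positivity
    set δ := ε / (c + 2) with hδ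
    have hδ0 : 0 < δ := by positivity
    have hε_eq : 2 * δ + 6 * δ / (1 - laplaceOne F) * Real.exp T = ε := by
      have h1 : 6 * δ / (1 - laplaceOne F) * Real.exp T = δ * c := by rw [hc]; ring
      rw [h1, hδ]
      field_simp
      ring
    refine ((hQ₀_whp δ hδ0).and ((tendstoUCP_iff.1 hE_lim T hT δ hδ0).and
      ((holdsWHP_residualCount hq₀ hQ₀_whp hF_lim hT hδ0).and
        (holdsWHP_departures hη hη_law hη_indep (q₀ + e T + 2 * δ) hδ0)))).mono ?_
    filter_upwards [eventually_ge_atTop 1] with n hn ω ⟨h1, h2, h3, h4⟩ t ht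
    have hsol := h_queue n hn ω
    have h5 := hsol.abs_sub_fluid_le hF hn he_cadlag hq hδ0.le h1 h2 h3
      (fun s hs => h4 _ hsol.mono_A hsol.cadlag_A s
        (hsol.entrances_le hn hq₀ he_mono hδ0.le h1 h2 hs)) t ht
    exact ⟨h5.1.trans (by linarith), h5.2.trans hε_eq.le⟩
  refine ⟨q, hq, fun q' hq' => hq.unique hF he_cadlag hq', ?_, ?_⟩
  · exact tendstoUCP_iff.2 fun T hT ε hε =>
      (key T hT ε hε).mono (.of_forall fun n ω h t ht => (h t ht).1)
  · exact tendstoUCP_iff.2 fun T hT ε hε =>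
      (key T hT ε hε).mono (.of_forall fun n ω h t ht => (h t ht).2)
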